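/- A \emph{basic cube} is a cube $C=(x,y,z)+[0,1]^3$ with $(x,y,z)\in\mathbb Z^3$; it is white if $x+y+z$ is even and black otherwise. A \emph{domino} $d$ is the union of two basic cubes that share a face, and $v(d)$ is the centre of its black cube minus the centre of its white cube. For integers $L,M,N\ge 0$, a \emph{tiling} of the box $[0,L]\times[0,M]\times[0,N]$ is a covering of it by dominoes contained in it whose interiors are pairwise disjoint. For $u\in\{e_x,e_y,e_z\}$ and dominoes $d_0,d_1$ let $S^u(d_0)=\operatorname{int}\bigl((d_0+[0,\infty)u)\setminus d_0\bigr)$, let $$\tau^u(d_0,d_1)=\begin{cases}\tfrac14\det(v(d_1),v(d_0),u) & \text{if } d_1\cap S^u(d_0)\neq\emptyset,\\ 0 & \text{otherwise,}\end{cases}$$ and for a tiling $t$ let $T^u(t)=\sum_{d_0,d_1\in t}\tau^u(d_0,d_1)$. \textbf{Theorem.} For every tiling $t$ of a box $[0,L]\times[0,M]\times[0,N]$ one has $T^{e_x}(t)=T^{e_y}(t)=T^{e_z}(t)$; this common value is the \emph{twist} $\mathrm{Tw}(t)$. Let $\mathrm{maxtw}(L,M,N)$ be the maximum of $\mathrm{Tw}(t)$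 over all tilings $t$ of $[0,L]\times[0,M]\times[0,N]$. If $L,M,N\ge 2$ are integers, at least two of them strictly larger than $2$ and at least one of them even, then $$\frac1{162}\,LMN\min(L,M,N)\ \le\ \mathrm{maxtw}(L,M,N)\ \le\ \frac1{16}\,LMN\min(L,M,N).$$ Moreover, with the limits taken over triples $(L,M,N)$ of positive integers of which at least one is even, $$\limsup_{L,M,N\to\infty}\frac{\mathrm{maxtw}(L,M,N)}{LMN\min(L,M,N)}=\frac1{16}\qquad\text{and}\qquad \liminf_{L,M,N\to\infty}\frac{\mathrm{maxtw}(L,M,N)}{LMN\min(L,M,N)}\le\frac1{24}.$$ -/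

import Mathlib

namespace DominoTwist

/-- A basic cube of `ℝ³`: the integer point `c` stands for the closed unit cube `c + [0,1]³`. -/
abbrev Cube := Fin 3 → ℤ

/-- The cube at `(x, y, z)` is white if `x + y + z` is even, and black otherwise. -/
def IsWhite (c : Cube) : Prop := Even (c 0 + c 1 + c 2)

/-- Two basic cubes share a face. -/
def ShareFace (a b : Cube) : Prop :=
  ∃ i : Fin 3, b = a + Pi.single i 1 ∨ a = b + Pi.single i 1

/-- A domino: the union of two basic cubes that share a face. Exactly one of the two is white,
so a domino is recorded by its white cube and its black cube. -/
@[ext]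
structure Domino where
  white : Cube
  black : Cube
  isWhite_white : IsWhite white
  shareFace : ShareFace white black

/-- The two cubes that make up a domino. -/
def Domino.cubes (d : Domino) : Set Cube := {d.white, d.black}

/-- The vector `v(d)`: the centre of the black cube minus the centre of the white cube. -/
def Domino.vec (d : Domino) : Fin 3 → ℤ := d.black - d.white

/-- `d₁` meets the open `u`-shade `interior ((d₀ + [0,∞) u) \ d₀)` of `d₀`, for a unit coordinate
vector `u`. That shade is the interior of a union of basic cubes (minus boundary points), namely
of the translates by `k u`, `k ≥ 0`, of the cubes of `d₀`, the cubes of `d₀` being removed; as it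
is open, `d₁` meets it exactly if one of the cubes of `d₁` is among these. -/
def MeetsShade (u : Fin 3 → ℤ) (d₀ d₁ : Domino) : Prop :=
  ∃ c₀ ∈ d₀.cubes, ∃ c₁ ∈ d₁.cubes, c₁ ∉ d₀.cubes ∧ ∃ k : ℕ, c₁ = c₀ + (k : ℤ) • u

open Classical in
/-- The effect `τ^u(d₀, d₁)` of `d₀` on `d₁` along `u`. -/
noncomputable def effect (u : Fin 3 → ℤ) (d₀ d₁ : Domino) : ℝ :=
  if MeetsShade u d₀ d₁ then
    (1 / 4 : ℝ) * ((Matrix.det (Matrix.of ![d₁.vec, d₀.vec, u]) : ℤ) : ℝ)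
  else 0

/-- The `u`-pretwist `T^u(t)`: the sum of the effects along `u` over all ordered pairs of
dominoes. -/
noncomputable def pretwist (u : Fin 3 → ℤ) (t : Finset Domino) : ℝ :=
  ∑ d₀ ∈ t, ∑ d₁ ∈ t, effect u d₀ d₁

/-- The canonical basis vectors `e_x`, `e_y`, `e_z` (for `i = 0`, `1`, `2`). -/
def basisVec (i : Fin 3) : Fin 3 → ℤ := Pi.single i 1

/-- The twist of a tiling of a box. It is the common value of the pretwists along `e_x`, `e_y`
and `e_z`, so it may be computed along `e_z`. -/
noncomputable def twist (t : Finset Domino) : ℝ := pretwist (basisVec 2) t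

/-- The basic cubes contained in `[0,L] × [0,M] × [0,N]`. -/
def box (L M N : ℕ) : Set Cube :=
  {c | (0 ≤ c 0 ∧ c 0 < L) ∧ (0 ≤ c 1 ∧ c 1 < M) ∧ (0 ≤ c 2 ∧ c 2 < N)}

/-- `t` is a tiling of the box `[0,L] × [0,M] × [0,N]`: its dominoes are contained in the box,
and every basic cube of the box is covered by exactly one of them. -/
def IsTiling (L M N : ℕ) (t : Finset Domino) : Prop :=
  (∀ d ∈ t, d.cubes ⊆ box L M N) ∧ ∀ c ∈ box L M N, ∃! d, d ∈ t ∧ c ∈ d.cubes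

/-- The set `Tw([0,L] × [0,M] × [0,N])` of the twists of all tilings of the box. -/
def twistSet (L M N : ℕ) : Set ℝ := {r | ∃ t : Finset Domino, IsTiling L M N t ∧ twist t = r}

/-- The largest twist of a tiling of the box. -/
noncomputable def maxTwist (L M N : ℕ) : ℝ := sSup (twistSet L M N)

theorem finite_box (L M N : ℕ) : (box L M N).Finite := by
  refine Set.Finite.subset
    (Set.finite_Icc (![0, 0, 0] : Cube) ![(L : ℤ), (M : ℤ), (N : ℤ)]) ?_
  rintro c ⟨⟨h0, h0'⟩, ⟨h1, h1'⟩, ⟨h2, h2'⟩⟩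
  constructor
  · intro i
    fin_cases i <;> simpa
  · intro i
    fin_cases i <;> simp <;> omega

theorem finite_twistSet (L M N : ℕ) : (twistSet L M N).Finite := by
  have hD : {d : Domino | d.cubes ⊆ box L M N}.Finite := by
    refine Set.Finite.of_finite_image (f := fun d : Domino => (d.white, d.black)) ?_ ?_
    · refine ((finite_box L M N).prod (finite_box L M N)).subset ?_
      rintro _ ⟨d, hd, rfl⟩
      exact ⟨hd (Or.inl rfl), hd (Or.inr rfl)⟩
    · intro d _ d' _ h
      exact Domino.ext (congrArg Prod.fst h) (congrArg Prod.snd h)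
  refine ((hD.toFinset.powerset.finite_toSet).image twist).subset ?_
  rintro r ⟨t, ht, rfl⟩
  refine ⟨t, ?_, rfl⟩
  simp only [Finset.coe_powerset, Set.mem_preimage, Set.mem_powerset_iff]
  intro d hd
  simpa using ht.1 d hd

/-- If the box has a tiling, `maxTwist` is a maximum that is attained. -/
theorem isGreatest_maxTwist {L M N : ℕ} (h : (twistSet L M N).Nonempty) :
    IsGreatest (twistSet L M N) (maxTwist L M N) :=
  ⟨h.csSup_mem (finite_twistSet L M N),
    fun _ hr => le_csSup (finite_twistSet L M N).bddAbove hr⟩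

/-- The normalised maximal twist of the `L × M × N` box. -/
noncomputable def ratio (p : ℕ × ℕ × ℕ) : ℝ :=
  maxTwist p.1 p.2.1 p.2.2 /
    ((p.1 : ℝ) * p.2.1 * p.2.2 * min (p.1 : ℝ) (min (p.2.1 : ℝ) p.2.2))

/-- `L, M, N → ∞` through the triples with at least one even entry, that is, through the boxes
that have a tiling. -/
def toInftyTileable : Filter (ℕ × ℕ × ℕ) :=
  (Filter.atTop ×ˢ Filter.atTop ×ˢ Filter.atTop) ⊓
    Filter.principal {p | Even p.1 ∨ Even p.2.1 ∨ Even p.2.2}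

end DominoTwist

namespace DominoTwist

/-! ### Pairs of dominoes -/

/-! Equality of the pretwists. Attach to two cubes the product of the signs of their three
coordinate differences, and to two dominoes the sum of these products over their pairs of cubes,
signed by colour (`pairing`). For perpendicular dominoes the differences along their own axes turn
two of the signs into the condition that one shades the other, and the third sign tells which is on
top. Hence T^{e_i} is -1/4 times the total pairing A(i+1, i+2) of the dominoes parallel to e_{i+1}
with those parallel to e_{i+2} (`effect_add_effect`, `pretwist_eq_axisPairing`). The pairing is
antisymmetric. In a tiled box each domino has total pairing 0 with the tiling, because the
colour-weighted sum of sign products over the box does not depend on the base cube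
(`IsTiling.sum_pairing`). So A(i,i) = 0 and A(i,i+1) = -A(i,i+2) = A(i+2,i), which makes the three
pretwists equal.

Upper bounds. Along a line of n cubes parallel to e_i only pairs with domino directions e_{i+1} and
e_{i+2} count. If these occur a and b times, then 4ab ≤ (a+b)² ≤ n(a+b), so T^{e_i} is at most n/16
times the number of cubes in dominoes perpendicular to e_i (`pretwist_le`). Taking the shortest side
gives 1/16. In a cube, adding the three bounds counts each basic cube twice, and gives 1/24, which
settles the liminf.

Lower bounds. In a (4a+2w) × B × H box, two stacks of concentric rings of thickness a are threaded
by the two arms, of thickness w, of one loop (`linkedRings`). A column through a ring and an arm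
meets x-dominoes, y-dominoes and oppositely directed x-dominoes, all contributing with the same
sign; columns near the two ends cancel by reflection. The twist is aw(B-2w)(H-2a)
(`linkedRings_mem_twistSet`). With a = H/4 and a ≪ w ≪ B this approaches the bound 1/16. Turning and
gluing boxes reduces the constant 1/162 to this family and, for short sides, to 3 × 3 × 2 blocks of
twist 1. -/

/-- `1` if `a = b` and `0` otherwise. -/
def dlt (a b : ℤ) : ℤ := if a = b then 1 else 0

/-- `1` if `a < b` and `0` otherwise. -/
def ltn (a b : ℤ) : ℤ := if a < b then 1 else 0

/-- `1` if `c₁` lies strictly above `c₀` on a line parallel to `e_i`, and `0` otherwise. -/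
def above (i : Fin 3) (c₀ c₁ : Cube) : ℤ :=
  ltn (c₀ i) (c₁ i) * (dlt (c₀ (i + 1)) (c₁ (i + 1)) * dlt (c₀ (i + 2)) (c₁ (i + 2)))

/-- The `i`-th coordinate of the cross product `v × w`. -/
def cross (i : Fin 3) (v w : Fin 3 → ℤ) : ℤ := v (i + 1) * w (i + 2) - v (i + 2) * w (i + 1)

theorem det_basisVec (i : Fin 3) (v w : Fin 3 → ℤ) :
    Matrix.det (Matrix.of ![v, w, basisVec i]) = cross i v w := by
  fin_cases i <;> simp [Matrix.det_fin_three, cross, basisVec]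
  ring

theorem Domino.exists_eq (d : Domino) :
    ∃ j : Fin 3, ∃ s : ℤ, (s = 1 ∨ s = -1) ∧ d.black = d.white + Pi.single j s := by
  obtain ⟨j, h | h⟩ := d.shareFace
  · exact ⟨j, 1, Or.inl rfl, h⟩
  · refine ⟨j, -1, Or.inr rfl, ?_⟩
    rw [h, add_assoc, ← Pi.single_add]; simp

theorem above_nonneg (i : Fin 3) (a b : Cube) : 0 ≤ above i a b := by
  unfold above ltn dlt; positivity

theorem above_ne_zero {i : Fin 3} {a b : Cube} :
    above i a b ≠ 0 ↔ a i < b i ∧ a (i + 1) = b (i + 1) ∧ a (i + 2) = b (i + 2) := by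
  unfold above ltn dlt; split_ifs <;> simp_all

theorem eq_add_smul_basisVec {i : Fin 3} {a b : Cube} :
    (∃ k : ℕ, b = a + (k : ℤ) • basisVec i) ↔
      a i ≤ b i ∧ a (i + 1) = b (i + 1) ∧ a (i + 2) = b (i + 2) := by
  constructor
  · rintro ⟨k, rfl⟩
    fin_cases i <;> simp [basisVec]
  · rintro ⟨h, h1, h2⟩
    refine ⟨(b i - a i).toNat, ?_⟩
    ext j
    fin_cases i <;> fin_cases j <;> simp_all [basisVec]

/-- The number of pairs of cubes of `d₀` and `d₁` of which the second lies above the first. -/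
def aboveCount (i : Fin 3) (d₀ d₁ : Domino) : ℤ :=
  above i d₀.white d₁.white + above i d₀.white d₁.black +
    above i d₀.black d₁.white + above i d₀.black d₁.black

/-- Both cubes of `d₀` lie at the same height, so discarding the cubes of `d₀` from its shade
amounts to making the height inequality strict. -/
theorem meetsShade_iff {i : Fin 3} {d₀ d₁ : Domino} (h : d₀.black i = d₀.white i) :
    MeetsShade (basisVec i) d₀ d₁ ↔
      ∃ c₀ ∈ d₀.cubes, ∃ c₁ ∈ d₁.cubes, above i c₀ c₁ ≠ 0 := by
  unfold MeetsShade
  simp only [eq_add_smul_basisVec, above_ne_zero]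
  constructor
  · rintro ⟨c₀, h₀, c₁, h₁, hn, hle, e1, e2⟩
    refine ⟨c₀, h₀, c₁, h₁, lt_of_le_of_ne hle ?_, e1, e2⟩
    intro he
    apply hn
    have : c₁ = c₀ := by
      ext j; fin_cases i <;> fin_cases j <;> simp_all
    rwa [this]
  · rintro ⟨c₀, h₀, c₁, h₁, hlt, e1, e2⟩
    refine ⟨c₀, h₀, c₁, h₁, ?_, hlt.le, e1, e2⟩
    intro hm
    have e0 : c₀ i = d₀.white i := by rcases h₀ with rfl | rfl <;> simp [h]
    have e3 : c₁ i = d₀.white i := by rcases hm with rfl | rfl <;> simp [h]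
    omega

theorem ltn_eq (a b : ℤ) : ltn a b = 0 ∨ ltn a b = 1 := by
  unfold ltn; split_ifs <;> simp

theorem dlt_add_dlt {a b : ℤ} (h : a ≠ b) (c : ℤ) :
    dlt a c + dlt b c = 0 ∨ dlt a c + dlt b c = 1 := by
  unfold dlt; split_ifs <;> simp_all

theorem dlt_add_dlt' {a b : ℤ} (h : a ≠ b) (c : ℤ) :
    dlt c a + dlt c b = 0 ∨ dlt c a + dlt c b = 1 := by
  unfold dlt; split_ifs <;> simp_all

/-- If the cross product is nonzero, the dominoes are perpendicular to each other and to e_i. Then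
`aboveCount` factors into three quantities that are 0 or 1, so at most one pair of cubes is stacked,
and the count is the indicator of the shade condition. -/
theorem effect_basisVec (i : Fin 3) (d₀ d₁ : Domino) :
    effect (basisVec i) d₀ d₁ =
      (1 / 4 : ℝ) * ((cross i d₁.vec d₀.vec * aboveCount i d₀ d₁ : ℤ) : ℝ) := by
  unfold effect
  rw [det_basisVec]
  by_cases hc : cross i d₁.vec d₀.vec = 0
  · simp [hc]
  have hd0 : d₀.black i = d₀.white i ∧ (d₀.vec (i+1) ≠ 0 ∧ d₁.vec (i+2) ≠ 0 ∧
      d₀.black (i+2) = d₀.white (i+2) ∧ d₁.black (i+1) = d₁.white (i+1) ∧ d₁.black i = d₁.white i ∨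
      d₀.vec (i+2) ≠ 0 ∧ d₁.vec (i+1) ≠ 0 ∧
      d₀.black (i+1) = d₀.white (i+1) ∧ d₁.black (i+2) = d₁.white (i+2) ∧
        d₁.black i = d₁.white i) := by
    obtain ⟨j, s, hs, h⟩ := d₀.exists_eq
    obtain ⟨j', s', hs', h'⟩ := d₁.exists_eq
    simp only [cross, Domino.vec, h, h'] at hc ⊢
    fin_cases i <;> fin_cases j <;> fin_cases j' <;> revert hc <;> simp <;> tauto
  classical
  have key : aboveCount i d₀ d₁ = if MeetsShade (basisVec i) d₀ d₁ then 1 else 0 := by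
    rw [meetsShade_iff hd0.1]
    have hex : (∃ c₀ ∈ d₀.cubes, ∃ c₁ ∈ d₁.cubes, above i c₀ c₁ ≠ 0) ↔ aboveCount i d₀ d₁ ≠ 0 := by
      have h1 := above_nonneg i d₀.white d₁.white
      have h2 := above_nonneg i d₀.white d₁.black
      have h3 := above_nonneg i d₀.black d₁.white
      have h4 := above_nonneg i d₀.black d₁.black
      simp only [Domino.cubes, Set.mem_insert_iff, Set.mem_singleton_iff, exists_eq_or_imp,
        exists_eq_left, aboveCount]
      omega
    rw [hex]
    obtain ⟨e0, ⟨n1, n2, e1, e2, hz⟩ | ⟨n1, n2, e1, e2, hz⟩⟩ := hd0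
    all_goals
      simp only [Domino.vec, Pi.sub_apply, sub_ne_zero] at n1 n2
    · have e : aboveCount i d₀ d₁ = ltn (d₀.white i) (d₁.white i) *
          ((dlt (d₀.white (i + 1)) (d₁.white (i + 1)) + dlt (d₀.black (i + 1)) (d₁.white (i + 1))) *
          (dlt (d₀.white (i + 2)) (d₁.white (i + 2)) +
            dlt (d₀.white (i + 2)) (d₁.black (i + 2)))) := by
        unfold aboveCount above; rw [e0, e1, e2, hz]; ring
      rw [e]
      rcases ltn_eq (d₀.white i) (d₁.white i) with h | h <;>
      rcases dlt_add_dlt n1.symm (d₁.white (i + 1)) with h' | h' <;>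
      rcases dlt_add_dlt' n2.symm (d₀.white (i + 2)) with h'' | h'' <;> simp [h, h', h'']
    · have e : aboveCount i d₀ d₁ = ltn (d₀.white i) (d₁.white i) *
          ((dlt (d₀.white (i + 1)) (d₁.white (i + 1)) + dlt (d₀.white (i + 1)) (d₁.black (i + 1))) *
          (dlt (d₀.white (i + 2)) (d₁.white (i + 2)) +
            dlt (d₀.black (i + 2)) (d₁.white (i + 2)))) := by
        unfold aboveCount above; rw [e0, e1, e2, hz]; ring
      rw [e]
      rcases ltn_eq (d₀.white i) (d₁.white i) with h | h <;>
      rcases dlt_add_dlt n1.symm (d₁.white (i + 2)) with h' | h' <;>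
      rcases dlt_add_dlt' n2.symm (d₀.white (i + 1)) with h'' | h'' <;> simp [h, h', h'']
  rw [key]
  by_cases hm : MeetsShade (basisVec i) d₀ d₁ <;> simp [hm]

/-! ### A pairing of dominoes that treats the three axes alike -/

/-- The product of the signs of the differences of the coordinates. -/
def signProd (c c' : Cube) : ℤ :=
  (c 0 - c' 0).sign * (c 1 - c' 1).sign * (c 2 - c' 2).sign

/-- The signed sum of `signProd` over the pairs of cubes of two dominoes. -/
def pairing (d d' : Domino) : ℤ :=
  signProd d.white d'.white - signProd d.white d'.black - signProd d.black d'.white +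
    signProd d.black d'.black

theorem signProd_swap (c c' : Cube) : signProd c' c = - signProd c c' := by
  unfold signProd
  rw [← neg_sub (c 0), ← neg_sub (c 1), ← neg_sub (c 2)]
  simp only [Int.sign_neg]; ring

theorem pairing_swap (d d' : Domino) : pairing d' d = - pairing d d' := by
  unfold pairing
  rw [signProd_swap d.white d'.white, signProd_swap d.black d'.white,
    signProd_swap d.white d'.black, signProd_swap d.black d'.black]
  ring

theorem signProd_eq (i : Fin 3) (c c' : Cube) : signProd c c' =
    (c i - c' i).sign * (c (i + 1) - c' (i + 1)).sign * (c (i + 2) - c' (i + 2)).sign := by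
  fin_cases i <;> simp [signProd] <;> ring

theorem sign_sub_eq (a b : ℤ) : (a - b).sign = ltn b a - ltn a b := by
  unfold ltn
  rcases lt_trichotomy a b with h | h | h
  · rw [Int.sign_eq_neg_one_of_neg (by omega)]; simp [h, not_lt_of_gt h]
  · simp [h]
  · rw [Int.sign_eq_one_of_pos (by omega)]; simp [h, not_lt_of_gt h]

theorem ltn_add_one (a b : ℤ) : ltn (a + 1) b = ltn a b - dlt (a + 1) b := by
  unfold ltn dlt; split_ifs <;> omega

theorem ltn_add_one' (a b : ℤ) : ltn b (a + 1) = ltn b a + dlt a b := by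
  unfold ltn dlt; split_ifs <;> omega

theorem ltn_neg_one (a b : ℤ) : ltn (a + -1) b = ltn a b + dlt a b := by
  unfold ltn dlt; split_ifs <;> omega

theorem ltn_neg_one' (a b : ℤ) : ltn b (a + -1) = ltn b a - dlt (a + -1) b := by
  unfold ltn dlt; split_ifs <;> omega

theorem dlt_comm (a b : ℤ) : dlt a b = dlt b a := by
  unfold dlt; split_ifs <;> omega

theorem eq_or_eq_add (i j : Fin 3) : j = i ∨ j = i + 1 ∨ j = i + 2 := by
  revert i j; decide

theorem add_ne_self (i : Fin 3) : i + 1 ≠ i ∧ i + 2 ≠ i ∧ i + 2 ≠ i + 1 := by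
  revert i; decide

/-- The squares select the pairs with one domino parallel to e_{i+1} and the other to e_{i+2}.
Moving by one cube changes a sign by Kronecker deltas; doing this along both dominoes leaves the
overlap condition times the sign of the difference in height. -/
theorem effect_add_effect (i : Fin 3) (d d' : Domino) :
    effect (basisVec i) d d' + effect (basisVec i) d' d = -(1 / 4 : ℝ) *
      ((d.vec (i + 1) ^ 2 * d'.vec (i + 2) ^ 2 * pairing d d' +
        d'.vec (i + 1) ^ 2 * d.vec (i + 2) ^ 2 * pairing d' d : ℤ) : ℝ) := by
  have key : cross i d'.vec d.vec * aboveCount i d d' + cross i d.vec d'.vec * aboveCount i d' d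
     = -(d.vec (i + 1) ^ 2 * d'.vec (i + 2) ^ 2 * pairing d d' +
        d'.vec (i + 1) ^ 2 * d.vec (i + 2) ^ 2 * pairing d' d) := by
    rw [pairing_swap d d']
    unfold pairing aboveCount cross Domino.vec
    simp only [signProd_eq i, sign_sub_eq, above]
    obtain ⟨j, s, hs, h⟩ := d.exists_eq
    obtain ⟨j', s', hs', h'⟩ := d'.exists_eq
    have hj := eq_or_eq_add i j
    have hj' := eq_or_eq_add i j'
    obtain ⟨a1, a2, a3⟩ := add_ne_self i
    simp only [h, h']
    generalize d.white = u
    generalize d'.white = u'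
    rcases hj with rfl | rfl | rfl <;> rcases hj' with rfl | rfl | rfl <;>
      simp only [Pi.sub_apply, Pi.add_apply, Pi.single_eq_same, Pi.single_eq_of_ne a1,
        Pi.single_eq_of_ne a2, Pi.single_eq_of_ne a3, Pi.single_eq_of_ne a1.symm,
        Pi.single_eq_of_ne a2.symm, Pi.single_eq_of_ne a3.symm, add_zero, sub_self,
        add_sub_cancel_left] <;> try ring1
    all_goals
      rcases hs with rfl | rfl <;> rcases hs' with rfl | rfl <;>
      simp only [ltn_add_one, ltn_add_one', ltn_neg_one, ltn_neg_one',
        dlt_comm (u' _) (u _), dlt_comm (u' _) (u _ + 1), dlt_comm (u' _) (u _ + -1),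
        dlt_comm (u' _ + 1) (u _), dlt_comm (u' _ + -1) (u _)] <;> ring
  rw [effect_basisVec, effect_basisVec, ← mul_add, ← Int.cast_add, key]
  push_cast; ring

/-! ### Sums over the cubes of a box, and the equality of the pretwists -/

/-- The basic cubes of the box, as a finite set. -/
noncomputable def boxCubes (L M N : ℕ) : Finset Cube := (finite_box L M N).toFinset

theorem mem_boxCubes {L M N : ℕ} {c : Cube} : c ∈ boxCubes L M N ↔ c ∈ box L M N := by
  simp [boxCubes]

theorem sum_boxCubes {A : Type*} [AddCommMonoid A] (L M N : ℕ) (g : Cube → A) :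
    ∑ c ∈ boxCubes L M N, g c =
      ∑ x ∈ Finset.range L, ∑ y ∈ Finset.range M, ∑ z ∈ Finset.range N,
        g ![(x : ℤ), (y : ℤ), (z : ℤ)] := by
  simp only [← Finset.sum_product']
  symm
  refine Finset.sum_bij (fun p _ => ![(p.1 : ℤ), (p.2.1 : ℤ), (p.2.2 : ℤ)]) ?_ ?_ ?_ ?_
  · rintro ⟨x, y, z⟩ h
    simp only [Finset.mem_product, Finset.mem_range] at h
    simp only [mem_boxCubes, box, Set.mem_ofPred_eq, Matrix.cons_val]
    omega
  · rintro ⟨x, y, z⟩ - ⟨x', y', z'⟩ - h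
    have h0 := congrFun h 0
    have h1 := congrFun h 1
    have h2 := congrFun h 2
    simp only [Matrix.cons_val] at h0 h1 h2
    simp only [Prod.mk.injEq]
    omega
  · intro c hc
    rw [mem_boxCubes] at hc
    obtain ⟨⟨h0, h0'⟩, ⟨h1, h1'⟩, ⟨h2, h2'⟩⟩ := hc
    refine ⟨((c 0).toNat, (c 1).toNat, (c 2).toNat), ?_, ?_⟩
    · simp only [Finset.mem_product, Finset.mem_range]
      omega
    · ext j
      fin_cases j <;> simp [h0, h1, h2]
  · intros; rfl

theorem IsTiling.exists_owner {L M N : ℕ} {t : Finset Domino} (h : IsTiling L M N t) :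
    ∃ D : Cube → Domino, ∀ c ∈ box L M N, D c ∈ t ∧ c ∈ (D c).cubes := by
  classical
  have h2 : ∀ c : Cube, ∃ d : Domino, c ∈ box L M N → d ∈ t ∧ c ∈ d.cubes := by
    intro c
    by_cases hc : c ∈ box L M N
    · obtain ⟨d, hd, -⟩ := h.2 c hc
      exact ⟨d, fun _ => hd⟩
    · exact ⟨⟨0, Pi.single 0 1, by simp [IsWhite], ⟨0, Or.inl (by simp)⟩⟩, fun h => absurd h hc⟩
  choose D hD using h2
  exact ⟨D, hD⟩

theorem Domino.white_ne_black (d : Domino) : d.white ≠ d.black := by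
  obtain ⟨j, s, hs, h⟩ := d.exists_eq
  intro he
  have := congrFun (he.trans h) j
  simp only [Pi.add_apply, Pi.single_eq_same] at this
  omega

/-- The fibre of `D` over a domino of the tiling is its pair of cubes; this is how sums over
dominoes become sums over the box. -/
theorem sum_owner {A : Type*} [AddCommMonoid A] {L M N : ℕ} {t : Finset Domino}
    (h : IsTiling L M N t) {D : Cube → Domino}
    (hD : ∀ c ∈ box L M N, D c ∈ t ∧ c ∈ (D c).cubes) (g : Domino → Cube → A) :
    ∑ d ∈ t, (g d d.white + g d d.black) = ∑ c ∈ boxCubes L M N, g (D c) c := by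
  classical
  rw [← Finset.sum_fiberwise_of_maps_to (t := t) (g := D)
    (fun c hc => (hD c (mem_boxCubes.1 hc)).1)]
  refine Finset.sum_congr rfl fun d hd => ?_
  have hf : (boxCubes L M N).filter (fun c => D c = d) = {d.white, d.black} := by
    ext c
    simp only [Finset.mem_filter, mem_boxCubes, Finset.mem_insert, Finset.mem_singleton]
    constructor
    · rintro ⟨hc, rfl⟩
      exact (hD c hc).2
    · intro hc
      have hb : c ∈ box L M N := h.1 d hd hc
      exact ⟨hb, (h.2 c hb).unique (hD c hb) ⟨hd, hc⟩⟩
  have : ∑ c ∈ (boxCubes L M N).filter (fun c => D c = d), g (D c) c =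
      ∑ c ∈ (boxCubes L M N).filter (fun c => D c = d), g d c :=
    Finset.sum_congr rfl fun c hc => by rw [(Finset.mem_filter.1 hc).2]
  rw [this, hf, Finset.sum_pair d.white_ne_black]

open Classical in
/-- `1` for white cubes and `-1` for black ones. -/
noncomputable def colour (c : Cube) : ℤ := if IsWhite c then 1 else -1

theorem isWhite_iff (c : Cube) : IsWhite c ↔ (c 0 + c 1 + c 2) % 2 = 0 := by
  unfold IsWhite; exact Int.even_iff

theorem Domino.not_isWhite_black (d : Domino) : ¬ IsWhite d.black := by
  obtain ⟨j, s, hs, h⟩ := d.exists_eq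
  have hw := d.isWhite_white
  rw [isWhite_iff] at hw ⊢
  rw [h]
  fin_cases j <;> simp <;> omega

theorem Domino.colour_white (d : Domino) : colour d.white = 1 := by
  simp [colour, d.isWhite_white]

theorem Domino.colour_black (d : Domino) : colour d.black = -1 := by
  simp [colour, d.not_isWhite_black]

theorem colour_natCast (x y z : ℕ) :
    colour ![(x : ℤ), (y : ℤ), (z : ℤ)] = (-1) ^ x * (-1) ^ y * (-1) ^ z := by
  rw [← pow_add, ← pow_add]
  have : IsWhite ![(x : ℤ), (y : ℤ), (z : ℤ)] ↔ Even (x + y + z) := by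
    rw [← Int.even_coe_nat]; push_cast; rfl
  unfold colour
  by_cases h : Even (x + y + z)
  · rw [if_pos (this.2 h), h.neg_one_pow]
  · rw [if_neg (mt this.1 h), (Nat.not_even_iff_odd.1 h).neg_one_pow]

/-- What matters is that the value does not depend on `n`. -/
theorem sum_neg_one_pow_mul_sign (n L : ℕ) (h : n < L) :
    ∑ x ∈ Finset.range L, (-1 : ℤ) ^ x * ((n : ℤ) - x).sign = if Even L then 1 else 0 := by
  induction L, h using Nat.le_induction with
  | base =>
    rw [Finset.sum_range_succ]
    have : ∑ x ∈ Finset.range n, (-1 : ℤ) ^ x * ((n : ℤ) - x).sign =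
        ∑ x ∈ Finset.range n, (-1 : ℤ) ^ x := by
      refine Finset.sum_congr rfl fun x hx => ?_
      have := Finset.mem_range.1 hx
      rw [Int.sign_eq_one_of_pos (by omega), mul_one]
    rw [this, neg_one_geom_sum]
    by_cases he : Even n <;> simp [he, Nat.even_add_one]
  | succ L hL ih =>
    rw [Finset.sum_range_succ, ih, Int.sign_eq_neg_one_of_neg (by omega)]
    by_cases he : Even L
    · simp [he, Nat.even_add_one]
    · simp [he, Nat.even_add_one, (Nat.not_even_iff_odd.1 he).neg_one_pow]

theorem sum_colour_mul_signProd {L M N : ℕ} {c : Cube} (hc : c ∈ box L M N) :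
    ∑ c' ∈ boxCubes L M N, colour c' * signProd c c' =
      (if Even L then 1 else 0) * (if Even M then 1 else 0) * (if Even N then 1 else 0) := by
  obtain ⟨⟨h0, h0'⟩, ⟨h1, h1'⟩, ⟨h2, h2'⟩⟩ := hc
  rw [← sum_neg_one_pow_mul_sign (c 0).toNat L (by omega),
    ← sum_neg_one_pow_mul_sign (c 1).toNat M (by omega),
    ← sum_neg_one_pow_mul_sign (c 2).toNat N (by omega), Finset.sum_mul_sum, Finset.sum_mul,
    sum_boxCubes]
  refine Finset.sum_congr rfl fun x _ => ?_
  rw [Finset.sum_mul_sum]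
  refine Finset.sum_congr rfl fun y _ => Finset.sum_congr rfl fun z _ => ?_
  rw [colour_natCast]
  simp only [signProd, Matrix.cons_val, Int.toNat_of_nonneg h0, Int.toNat_of_nonneg h1,
    Int.toNat_of_nonneg h2]
  ring

/-- The sum is the difference, between the two cubes of `d`, of the colour-weighted sum of
`signProd` over the box, and that sum is the same for all base cubes. -/
theorem IsTiling.sum_pairing {L M N : ℕ} {t : Finset Domino} (h : IsTiling L M N t)
    {d : Domino} (hd : d ∈ t) : ∑ d' ∈ t, pairing d d' = 0 := by
  obtain ⟨D, hD⟩ := h.exists_owner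
  have key := sum_owner h hD (fun _ c' => colour c' * (signProd d.white c' - signProd d.black c'))
  have e : ∑ d' ∈ t, pairing d d' = ∑ d' ∈ t,
      (colour d'.white * (signProd d.white d'.white - signProd d.black d'.white) +
        colour d'.black * (signProd d.white d'.black - signProd d.black d'.black)) := by
    refine Finset.sum_congr rfl fun d' _ => ?_
    rw [d'.colour_white, d'.colour_black, pairing]; ring
  rw [e, key]
  simp only [mul_sub, Finset.sum_sub_distrib]
  rw [sum_colour_mul_signProd (h.1 d hd (Or.inl rfl)),
    sum_colour_mul_signProd (h.1 d hd (Or.inr rfl)), sub_self]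

/-! ### Pretwists as pairings of axis classes -/

theorem Domino.sum_sq_vec (d : Domino) (i : Fin 3) :
    d.vec i ^ 2 + d.vec (i + 1) ^ 2 + d.vec (i + 2) ^ 2 = 1 := by
  obtain ⟨j, s, hs, h⟩ := d.exists_eq
  unfold Domino.vec
  rw [h, add_sub_cancel_left]
  obtain ⟨a1, a2, a3⟩ := add_ne_self i
  rcases eq_or_eq_add i j with rfl | rfl | rfl <;> simp [a1, a2, a3, a1.symm, a2.symm, a3.symm] <;>
    omega

/-- The pairing of the dominoes parallel to `e_j` with those parallel to `e_k`. -/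
def axisPairing (t : Finset Domino) (j k : Fin 3) : ℤ :=
  ∑ d ∈ t, ∑ d' ∈ t, d.vec j ^ 2 * d'.vec k ^ 2 * pairing d d'

theorem axisPairing_swap (t : Finset Domino) (j k : Fin 3) :
    axisPairing t k j = - axisPairing t j k := by
  unfold axisPairing
  rw [Finset.sum_comm, ← Finset.sum_neg_distrib]
  refine Finset.sum_congr rfl fun d _ => ?_
  rw [← Finset.sum_neg_distrib]
  refine Finset.sum_congr rfl fun d' _ => ?_
  rw [pairing_swap d d']; ring

theorem pretwist_eq_axisPairing (t : Finset Domino) (i : Fin 3) :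
    pretwist (basisVec i) t = -(1 / 4 : ℝ) * axisPairing t (i + 1) (i + 2) := by
  have h1 : pretwist (basisVec i) t + pretwist (basisVec i) t =
      -(1 / 4 : ℝ) * (axisPairing t (i + 1) (i + 2) + axisPairing t (i + 1) (i + 2) : ℤ) := by
    -- Only the symmetrised effect is expressed by pairings, so the identity is proved for twice the
    -- pretwist, with the order of summation exchanged in one copy.
    conv_lhs => arg 2; unfold pretwist; rw [Finset.sum_comm]
    conv_rhs => arg 2; arg 1; arg 2; unfold axisPairing; rw [Finset.sum_comm]
    unfold pretwist axisPairing
    simp only [← Finset.sum_add_distrib, effect_add_effect]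
    simp only [← Finset.mul_sum]
    push_cast
    rfl
  push_cast at h1
  linarith

/-- The three axes exhaust the dominoes, so the row sum of `axisPairing` vanishes; antisymmetry
kills the diagonal entry and flips the remaining one. -/
theorem IsTiling.axisPairing_eq {L M N : ℕ} {t : Finset Domino} (h : IsTiling L M N t)
    (i : Fin 3) : axisPairing t i (i + 1) = axisPairing t (i + 2) i := by
  have h1 : axisPairing t i i + axisPairing t i (i + 1) + axisPairing t i (i + 2) = 0 := by
    unfold axisPairing
    rw [← Finset.sum_add_distrib, ← Finset.sum_add_distrib]
    refine Finset.sum_eq_zero fun d hd => ?_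
    rw [← Finset.sum_add_distrib, ← Finset.sum_add_distrib]
    have := h.sum_pairing hd
    rw [← mul_zero (d.vec i ^ 2), ← this, Finset.mul_sum]
    refine Finset.sum_congr rfl fun d' _ => ?_
    linear_combination (d.vec i ^ 2 * pairing d d') * d'.sum_sq_vec i
  have h2 := axisPairing_swap t i i
  have h3 := axisPairing_swap t i (i + 2)
  omega

/-- The pretwists of a tiling of a box along the three coordinate directions agree. -/
theorem IsTiling.pretwist_eq_twist {L M N : ℕ} {t : Finset Domino} (h : IsTiling L M N t)
    (i : Fin 3) : pretwist (basisVec i) t = twist t := by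
  unfold twist
  rw [pretwist_eq_axisPairing, pretwist_eq_axisPairing]
  have h0 := h.axisPairing_eq 0
  have h1 := h.axisPairing_eq 1
  have h2 := h.axisPairing_eq 2
  congr 2
  fin_cases i <;> simp at * <;> omega

/-- The pretwist of a tiling of a box as a sum over pairs of cubes. -/
theorem pretwist_eq_sum_cubes {L M N : ℕ} {t : Finset Domino}
    (h : IsTiling L M N t) {D : Cube → Domino}
    (hD : ∀ c ∈ box L M N, D c ∈ t ∧ c ∈ (D c).cubes) (i : Fin 3) :
    pretwist (basisVec i) t = (1 / 4 : ℝ) * ((∑ c ∈ boxCubes L M N, ∑ c' ∈ boxCubes L M N,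
      above i c c' * cross i (D c').vec (D c).vec : ℤ) : ℝ) := by
  rw [← sum_owner h hD (fun d c => ∑ c' ∈ boxCubes L M N, above i c c' * cross i (D c').vec d.vec)]
  unfold pretwist
  push_cast
  rw [Finset.mul_sum]
  refine Finset.sum_congr rfl fun d _ => ?_
  have e : ∀ c, ∑ c' ∈ boxCubes L M N, above i c c' * cross i (D c').vec d.vec =
      ∑ d' ∈ t, (above i c d'.white * cross i d'.vec d.vec +
        above i c d'.black * cross i d'.vec d.vec) := fun c =>
    (sum_owner h hD (fun d' c' => above i c c' * cross i d'.vec d.vec)).symm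
  have e' := congrArg (Int.cast : ℤ → ℝ) (congrArg₂ (· + ·) (e d.white) (e d.black))
  push_cast at e'
  rw [e', ← Finset.sum_add_distrib, Finset.mul_sum]
  refine Finset.sum_congr rfl fun d' _ => ?_
  rw [effect_basisVec, aboveCount]
  push_cast; ring

/-! ### Upper bounds -/

/-- On each fibre, with totals A and B, one has 4AB ≤ (A+B)² and A+B ≤ n. -/
theorem four_mul_sum_fiber_le {α β : Type*} [DecidableEq β] (S : Finset α) (key : α → β)
    (a b : α → ℤ) (n : ℕ) (ha : ∀ c, 0 ≤ a c) (hb : ∀ c, 0 ≤ b c) (hab : ∀ c, a c + b c ≤ 1)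
    (hn : ∀ k, (S.filter fun c => key c = k).card ≤ n) :
    4 * ∑ c ∈ S, ∑ c' ∈ S, (if key c = key c' then a c * b c' else 0) ≤
      n * ∑ c ∈ S, (a c + b c) := by
  have hmap : ∀ c ∈ S, key c ∈ S.image key := fun c hc => Finset.mem_image_of_mem key hc
  rw [← Finset.sum_fiberwise_of_maps_to hmap, ← Finset.sum_fiberwise_of_maps_to hmap,
    Finset.mul_sum, Finset.mul_sum]
  refine Finset.sum_le_sum fun k _ => ?_
  set F := S.filter fun c => key c = k with hF
  have e : ∑ c ∈ F, ∑ c' ∈ S, (if key c = key c' then a c * b c' else 0) =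
      (∑ c ∈ F, a c) * ∑ c ∈ F, b c := by
    rw [Finset.sum_mul]
    refine Finset.sum_congr rfl fun c hc => ?_
    rw [(Finset.mem_filter.1 hc).2, Finset.mul_sum, ← Finset.sum_filter]
    simp only [hF, eq_comm]
  rw [e, Finset.sum_add_distrib]
  have h1 : ∑ c ∈ F, a c + ∑ c ∈ F, b c ≤ n := by
    rw [← Finset.sum_add_distrib]
    calc ∑ c ∈ F, (a c + b c) ≤ ∑ c ∈ F, 1 := Finset.sum_le_sum fun c _ => hab c
      _ = F.card := by simp
      _ ≤ n := by exact_mod_cast hn k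
  have hA : 0 ≤ ∑ c ∈ F, a c := Finset.sum_nonneg fun c _ => ha c
  have hB : 0 ≤ ∑ c ∈ F, b c := Finset.sum_nonneg fun c _ => hb c
  nlinarith [sq_nonneg (∑ c ∈ F, a c - ∑ c ∈ F, b c)]

theorem card_line_le (L M N : ℕ) (i : Fin 3) (k : ℤ × ℤ) :
    ((boxCubes L M N).filter fun c => (c (i + 1), c (i + 2)) = k).card ≤ ![L, M, N] i := by
  have : (![L, M, N] i) = (Finset.Ico (0 : ℤ) (![L, M, N] i : ℕ)).card := by simp
  rw [this]
  refine Finset.card_le_card_of_injOn (fun c => c i) ?_ ?_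
  · intro c hc
    simp only [Finset.coe_filter, Set.mem_ofPred_eq, mem_boxCubes, box] at hc
    simp only [Finset.coe_Ico, Set.mem_Ico]
    fin_cases i <;> simp <;> omega
  · intro c hc c' hc' h
    simp only [Finset.coe_filter, Set.mem_ofPred_eq] at hc hc'
    have h2 := hc.2.trans hc'.2.symm
    simp only [Prod.mk.injEq] at h2
    ext j
    rcases eq_or_eq_add i j with rfl | rfl | rfl
    · exact h
    · exact h2.1
    · exact h2.2

theorem Domino.cross_le (i : Fin 3) (d d' : Domino) :
    cross i d'.vec d.vec ≤ d'.vec (i + 1) ^ 2 * d.vec (i + 2) ^ 2 +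
      d'.vec (i + 2) ^ 2 * d.vec (i + 1) ^ 2 := by
  have h := d.sum_sq_vec i
  have h' := d'.sum_sq_vec i
  have b : ∀ d : Domino, ∀ j, d.vec j = 0 ∨ d.vec j = 1 ∨ d.vec j = -1 := by
    intro d j
    have := d.sum_sq_vec j
    have h3 : d.vec j ^ 2 ≤ 1 := by nlinarith [sq_nonneg (d.vec (j + 1)), sq_nonneg (d.vec (j + 2))]
    have h4 := abs_le.1 ((sq_le_one_iff_abs_le_one _).1 h3)
    omega
  unfold cross
  rcases b d (i + 1) with h1 | h1 | h1 <;> rcases b d (i + 2) with h2 | h2 | h2 <;>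
  rcases b d' (i + 1) with h3 | h3 | h3 <;> rcases b d' (i + 2) with h4 | h4 | h4 <;>
  simp [h1, h2, h3, h4]

theorem above_add_above_le (i : Fin 3) (c c' : Cube) : above i c c' + above i c' c ≤
    if (c (i + 1), c (i + 2)) = (c' (i + 1), c' (i + 2)) then 1 else 0 := by
  unfold above ltn dlt
  by_cases h1 : c (i + 1) = c' (i + 1) <;> by_cases h2 : c (i + 2) = c' (i + 2) <;>
    simp [h1, h2, eq_comm]
  split_ifs <;> omega

/-- The upper bound for the pretwist that comes from counting, in each line parallel to `e_i`, the
cubes in dominoes perpendicular to `e_i`. -/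
theorem pretwist_le {L M N : ℕ} {t : Finset Domino} (h : IsTiling L M N t) {D : Cube → Domino}
    (hD : ∀ c ∈ box L M N, D c ∈ t ∧ c ∈ (D c).cubes) (i : Fin 3) :
    pretwist (basisVec i) t ≤ (1 / 16 : ℝ) * (((![L, M, N] i : ℕ) *
      ∑ c ∈ boxCubes L M N, ((D c).vec (i + 1) ^ 2 + (D c).vec (i + 2) ^ 2) : ℤ) : ℝ) := by
  rw [pretwist_eq_sum_cubes h hD i]
  have key := four_mul_sum_fiber_le (boxCubes L M N) (fun c => (c (i + 1), c (i + 2)))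
    (fun c => (D c).vec (i + 1) ^ 2) (fun c => (D c).vec (i + 2) ^ 2) (![L, M, N] i)
    (fun c => sq_nonneg _) (fun c => sq_nonneg _)
    (fun c => by have := (D c).sum_sq_vec i; nlinarith [sq_nonneg ((D c).vec i)])
    (card_line_le L M N i)
  have h2 : ∑ c ∈ boxCubes L M N, ∑ c' ∈ boxCubes L M N,
      above i c c' * cross i (D c').vec (D c).vec ≤
      ∑ c ∈ boxCubes L M N, ∑ c' ∈ boxCubes L M N,
        (if (c (i + 1), c (i + 2)) = (c' (i + 1), c' (i + 2)) then
          (D c).vec (i + 1) ^ 2 * (D c').vec (i + 2) ^ 2 else 0) := by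
    calc _ ≤ ∑ c ∈ boxCubes L M N, ∑ c' ∈ boxCubes L M N,
          (above i c c' * ((D c').vec (i + 1) ^ 2 * (D c).vec (i + 2) ^ 2) +
            above i c c' * ((D c').vec (i + 2) ^ 2 * (D c).vec (i + 1) ^ 2)) := by
          refine Finset.sum_le_sum fun c _ => Finset.sum_le_sum fun c' _ => ?_
          rw [← mul_add]
          exact mul_le_mul_of_nonneg_left ((D c).cross_le i (D c')) (above_nonneg i c c')
      -- Renaming c and c' in one of the two terms merges both vertical orders of a pair, which
      -- together only ask that the cubes lie on one line.
      _ = ∑ c ∈ boxCubes L M N, ∑ c' ∈ boxCubes L M N,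
          (above i c' c + above i c c') * ((D c).vec (i + 1) ^ 2 * (D c').vec (i + 2) ^ 2) := by
          simp only [Finset.sum_add_distrib, add_mul]
          congr 1
          · rw [Finset.sum_comm]
          · refine Finset.sum_congr rfl fun c _ => Finset.sum_congr rfl fun c' _ => ?_
            ring
      _ ≤ _ := by
          refine Finset.sum_le_sum fun c _ => Finset.sum_le_sum fun c' _ => ?_
          have h3 := above_add_above_le i c c'
          have h4 : 0 ≤ (D c).vec (i + 1) ^ 2 * (D c').vec (i + 2) ^ 2 := by positivity
          calc _ ≤ _ := mul_le_mul_of_nonneg_right ((add_comm _ _).trans_le h3) h4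
            _ = _ := by split_ifs <;> simp
  have h3 := (mul_le_mul_of_nonneg_left h2 (by norm_num : (0 : ℤ) ≤ 4)).trans key
  have h4 : ((4 * _ : ℤ) : ℝ) ≤ _ := Int.cast_le.2 h3
  rw [Int.cast_mul] at h4
  push_cast at h4 ⊢
  linarith

theorem card_boxCubes (L M N : ℕ) : (boxCubes L M N).card = L * M * N := by
  rw [Finset.card_eq_sum_ones, sum_boxCubes]; simp [mul_assoc]

theorem IsTiling.twist_le {L M N : ℕ} {t : Finset Domino} (h : IsTiling L M N t) (i : Fin 3) :
    twist t ≤ (1 / 16 : ℝ) * ((L : ℝ) * M * N * (![L, M, N] i : ℕ)) := by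
  obtain ⟨D, hD⟩ := h.exists_owner
  rw [← h.pretwist_eq_twist i]
  refine (pretwist_le h hD i).trans ?_
  have h1 : ∑ c ∈ boxCubes L M N, ((D c).vec (i + 1) ^ 2 + (D c).vec (i + 2) ^ 2) ≤
      ((L * M * N : ℕ) : ℤ) := by
    rw [← card_boxCubes, Finset.card_eq_sum_ones]
    push_cast
    refine Finset.sum_le_sum fun c _ => ?_
    have := (D c).sum_sq_vec i
    nlinarith [sq_nonneg ((D c).vec i)]
  have h2 : ((∑ c ∈ boxCubes L M N, ((D c).vec (i + 1) ^ 2 + (D c).vec (i + 2) ^ 2) : ℤ) : ℝ) ≤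
      (L : ℝ) * M * N := by
    have := (Int.cast_le (R := ℝ)).2 h1
    push_cast at this ⊢
    exact this
  rw [Int.cast_mul, Int.cast_natCast]
  have h3 : (0 : ℝ) ≤ (![L, M, N] i : ℕ) := Nat.cast_nonneg _
  nlinarith [mul_le_mul_of_nonneg_left h2 h3]

/-- Every domino is perpendicular to exactly two axes, so adding the three bounds gives 3 Tw ≤
2n⁴/16. -/
theorem IsTiling.twist_le_cube {n : ℕ} {t : Finset Domino} (h : IsTiling n n n t) :
    twist t ≤ (1 / 24 : ℝ) * ((n : ℝ) * n * n * n) := by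
  obtain ⟨D, hD⟩ := h.exists_owner
  have e : ∀ i : Fin 3, ![n, n, n] i = n := by intro i; fin_cases i <;> rfl
  have key : ∀ i : Fin 3, twist t ≤ (1 / 16 : ℝ) * (n * ∑ c ∈ boxCubes n n n,
      (((D c).vec (i + 1) : ℝ) ^ 2 + ((D c).vec (i + 2) : ℝ) ^ 2)) := by
    intro i
    have := pretwist_le h hD i
    rw [h.pretwist_eq_twist, e] at this
    push_cast at this
    exact this
  have h0 := key 0
  have h1 := key 1
  have h2 := key 2
  have hs : ∑ c ∈ boxCubes n n n,
      (((D c).vec 0 : ℝ) ^ 2 + ((D c).vec 1 : ℝ) ^ 2 + ((D c).vec 2 : ℝ) ^ 2) = n * n * n := by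
    have h3 : ∑ c ∈ boxCubes n n n, (((D c).vec 0 : ℝ) ^ 2 + ((D c).vec 1 : ℝ) ^ 2 +
        ((D c).vec 2 : ℝ) ^ 2) = ∑ c ∈ boxCubes n n n, (1 : ℝ) :=
      Finset.sum_congr rfl fun c _ => by exact_mod_cast (D c).sum_sq_vec 0
    rw [h3, Finset.sum_const, card_boxCubes]; simp
  simp only [Finset.sum_add_distrib, Fin.isValue, zero_add] at h0 h1 h2 hs
  rw [show (1 : Fin 3) + 1 = 2 from rfl, show (1 : Fin 3) + 2 = 0 from rfl] at h1
  rw [show (2 : Fin 3) + 1 = 0 from rfl, show (2 : Fin 3) + 2 = 1 from rfl] at h2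
  have h4 := congrArg (fun x => (n : ℝ) * x) hs
  nlinarith

theorem maxTwist_le (L M N : ℕ) : maxTwist L M N ≤
    (1 / 16 : ℝ) * ((L : ℝ) * M * N * min (L : ℝ) (min (M : ℝ) N)) := by
  -- Nonnegativity of the bound covers boxes without tilings, where the supremum is 0 by convention.
  refine Real.sSup_le ?_ (by positivity)
  rintro r ⟨t, ht, rfl⟩
  have h0 := ht.twist_le 0
  have h1 := ht.twist_le 1
  have h2 := ht.twist_le 2
  simp only [Matrix.cons_val] at h0 h1 h2
  rcases min_choice (L : ℝ) (min (M : ℝ) N) with h | h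
  · rw [h]; exact h0
  · rw [h]
    rcases min_choice (M : ℝ) N with h' | h'
    · rw [h']; exact h1
    · rw [h']; exact h2

theorem maxTwist_cube_le (n : ℕ) : maxTwist n n n ≤ (1 / 24 : ℝ) * ((n : ℝ) * n * n * n) := by
  refine Real.sSup_le ?_ (by positivity)
  rintro r ⟨t, ht, rfl⟩
  exact ht.twist_le_cube

/-! ### Moving and gluing tilings -/

theorem shareFace_iff (a b : Cube) : ShareFace a b ↔
    (b 0 - a 0).natAbs + (b 1 - a 1).natAbs + (b 2 - a 2).natAbs = 1 := by
  constructor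
  · rintro ⟨j, rfl | rfl⟩ <;> fin_cases j <;> simp
  · intro h
    have h' : (b 0 = a 0 + 1 ∧ b 1 = a 1 ∧ b 2 = a 2) ∨ (b 0 = a 0 ∧ b 1 = a 1 + 1 ∧ b 2 = a 2) ∨
        (b 0 = a 0 ∧ b 1 = a 1 ∧ b 2 = a 2 + 1) ∨ (a 0 = b 0 + 1 ∧ a 1 = b 1 ∧ a 2 = b 2) ∨
        (a 0 = b 0 ∧ a 1 = b 1 + 1 ∧ a 2 = b 2) ∨ (a 0 = b 0 ∧ a 1 = b 1 ∧ a 2 = b 2 + 1) := by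
      have h3 : ∀ p q r : ℕ, p + q + r = 1 → (p = 1 ∧ q = 0 ∧ r = 0) ∨ (p = 0 ∧ q = 1 ∧ r = 0) ∨
        (p = 0 ∧ q = 0 ∧ r = 1) := by omega
      have h4 : ∀ x : ℤ, x.natAbs = 1 → x = 1 ∨ x = -1 := by omega
      rcases h3 _ _ _ h with ⟨h0, h1, h2⟩ | ⟨h0, h1, h2⟩ | ⟨h0, h1, h2⟩
      · rcases h4 _ h0 with h | h
        · left; omega
        · right; right; right; left; omega
      · rcases h4 _ h1 with h | h
        · right; left; omega
        · right; right; right; right; left; omega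
      · rcases h4 _ h2 with h | h
        · right; right; left; omega
        · right; right; right; right; right; omega
    have hl : ∀ (j : Fin 3) (u v : Cube), (∀ k, u k = v k + (Pi.single j 1 : Cube) k) →
        u = v + Pi.single j 1 := fun j u v h => funext h
    rcases h' with h | h | h | h | h | h
    · exact ⟨0, Or.inl (hl _ _ _ fun k => by fin_cases k <;> simp [h])⟩
    · exact ⟨1, Or.inl (hl _ _ _ fun k => by fin_cases k <;> simp [h])⟩
    · exact ⟨2, Or.inl (hl _ _ _ fun k => by fin_cases k <;> simp [h])⟩
    · exact ⟨0, Or.inr (hl _ _ _ fun k => by fin_cases k <;> simp [h])⟩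
    · exact ⟨1, Or.inr (hl _ _ _ fun k => by fin_cases k <;> simp [h])⟩
    · exact ⟨2, Or.inr (hl _ _ _ fun k => by fin_cases k <;> simp [h])⟩

theorem ShareFace.symm {a b : Cube} (h : ShareFace a b) : ShareFace b a := by
  rw [shareFace_iff] at *; omega

theorem ShareFace.isWhite_iff {a b : Cube} (h : ShareFace a b) : IsWhite a ↔ ¬ IsWhite b := by
  rw [shareFace_iff] at h
  rw [DominoTwist.isWhite_iff, DominoTwist.isWhite_iff]; omega

/-- `t` tiles the set of basic cubes `S`. -/
def IsTilingOn (S : Set Cube) (t : Finset Domino) : Prop :=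
  (∀ d ∈ t, d.cubes ⊆ S) ∧ ∀ c ∈ S, ∃! d, d ∈ t ∧ c ∈ d.cubes

/-- A map of the set of basic cubes that respects adjacency, the colouring up to a global swap,
and the data that enter effects along `e_i`. -/
structure IsRigid (i : Fin 3) (φ : Cube → Cube) : Prop where
  injective : Function.Injective φ
  shareFace : ∀ a b, ShareFace a b → ShareFace (φ a) (φ b)
  colour : ∃ s : ℤ, s * s = 1 ∧ ∀ c, colour (φ c) = s * colour c
  above : ∀ a b, above i (φ a) (φ b) = above i a b
  cross : ∀ a b a' b', cross i (φ b - φ a) (φ b' - φ a') = cross i (b - a) (b' - a')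

open Classical in
/-- The image of a domino. -/
noncomputable def Domino.map (φ : Cube → Cube) (hφ : ∀ a b, ShareFace a b → ShareFace (φ a) (φ b))
    (d : Domino) : Domino :=
  if h : IsWhite (φ d.white) then ⟨φ d.white, φ d.black, h, hφ _ _ d.shareFace⟩
  else ⟨φ d.black, φ d.white, not_not.1 (mt ((hφ _ _ d.shareFace).isWhite_iff).2 h),
    (hφ _ _ d.shareFace).symm⟩

theorem Domino.cubes_map (φ : Cube → Cube)
    (hφ : ∀ a b, ShareFace a b → ShareFace (φ a) (φ b)) (d : Domino) :
    (d.map φ hφ).cubes = φ '' d.cubes := by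
  unfold Domino.map Domino.cubes
  split_ifs
  · simp [Set.image_pair]
  · simp [Set.image_pair, Set.pair_comm]

theorem Domino.eq_of_cubes_eq {d d' : Domino} (h : d.cubes = d'.cubes) : d = d' := by
  have h1 : d.white ∈ d'.cubes := h ▸ Or.inl rfl
  have h2 : d.black ∈ d'.cubes := h ▸ Or.inr rfl
  have e1 : d.white = d'.white := h1.resolve_right fun e => d'.not_isWhite_black (e ▸ d.isWhite_white)
  have e2 : d.black = d'.black := h2.resolve_left fun e => d.not_isWhite_black (e ▸ d'.isWhite_white)
  exact Domino.ext e1 e2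

theorem Domino.map_injective {φ : Cube → Cube} (hi : Function.Injective φ)
    (hφ : ∀ a b, ShareFace a b → ShareFace (φ a) (φ b)) :
    Function.Injective (Domino.map φ hφ) := by
  intro d d' h
  have := congrArg Domino.cubes h
  rw [cubes_map, cubes_map] at this
  exact eq_of_cubes_eq (hi.image_injective this)

/-- A swap of colours negates both domino vectors, and the cross product is bilinear. -/
theorem IsRigid.effect_map {i : Fin 3} {φ : Cube → Cube} (h : IsRigid i φ) (d d' : Domino) :
    effect (basisVec i) (d.map φ h.shareFace) (d'.map φ h.shareFace) =
      effect (basisVec i) d d' := by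
  obtain ⟨s, hs, hc⟩ := h.colour
  rw [effect_basisVec, effect_basisVec]
  have hcount : aboveCount i (d.map φ h.shareFace) (d'.map φ h.shareFace) = aboveCount i d d' := by
    unfold aboveCount Domino.map
    split_ifs <;> simp only [h.above] <;> ring
  have hvec : ∀ d : Domino, (d.map φ h.shareFace).vec = s • (φ d.black - φ d.white) := by
    intro d
    have h1 := hc d.white
    rw [d.colour_white, DominoTwist.colour] at h1
    unfold Domino.map Domino.vec
    split_ifs at h1 ⊢
    · simp [show s = 1 by omega]
    · simp [show s = -1 by omega]
  have hcross : DominoTwist.cross i (d'.map φ h.shareFace).vec (d.map φ h.shareFace).vec =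
      DominoTwist.cross i d'.vec d.vec := by
    rw [hvec, hvec, Domino.vec, Domino.vec, ← h.cross]
    simp only [DominoTwist.cross, Pi.smul_apply, smul_eq_mul]
    linear_combination ((φ d'.black - φ d'.white) (i + 1) * (φ d.black - φ d.white) (i + 2) -
      (φ d'.black - φ d'.white) (i + 2) * (φ d.black - φ d.white) (i + 1)) * hs
  rw [hcount, hcross]

open Classical in
theorem IsRigid.pretwist_image {i : Fin 3} {φ : Cube → Cube} (h : IsRigid i φ)
    (t : Finset Domino) : pretwist (basisVec i) (t.image (Domino.map φ h.shareFace)) =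
      pretwist (basisVec i) t := by
  unfold pretwist
  have hi := Domino.map_injective h.injective h.shareFace
  rw [Finset.sum_image hi.injOn]
  refine Finset.sum_congr rfl fun d _ => ?_
  rw [Finset.sum_image hi.injOn]
  exact Finset.sum_congr rfl fun d' _ => h.effect_map d d'

open Classical in
theorem IsTilingOn.image {S : Set Cube} {t : Finset Domino} (ht : IsTilingOn S t) {φ : Cube → Cube}
    (hi : Function.Injective φ) (hφ : ∀ a b, ShareFace a b → ShareFace (φ a) (φ b)) :
    IsTilingOn (φ '' S) (t.image (Domino.map φ hφ)) := by
  constructor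
  · intro d hd
    obtain ⟨d, hd', rfl⟩ := Finset.mem_image.1 hd
    rw [Domino.cubes_map]
    exact Set.image_mono (ht.1 d hd')
  · rintro _ ⟨c, hc, rfl⟩
    obtain ⟨d, ⟨hd, hcd⟩, hu⟩ := ht.2 c hc
    refine ⟨d.map φ hφ, ⟨Finset.mem_image_of_mem _ hd, ?_⟩, ?_⟩
    · rw [Domino.cubes_map]; exact Set.mem_image_of_mem _ hcd
    · rintro d' ⟨hd', hc'⟩
      obtain ⟨d', h', rfl⟩ := Finset.mem_image.1 hd'
      rw [Domino.cubes_map, hi.mem_set_image] at hc'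
      rw [hu d' ⟨h', hc'⟩]

open Classical in
theorem IsTilingOn.union {S T : Set Cube} {t u : Finset Domino} (ht : IsTilingOn S t)
    (hu : IsTilingOn T u) (hST : Disjoint S T) : IsTilingOn (S ∪ T) (t ∪ u) := by
  have key : ∀ {S T : Set Cube} {t u : Finset Domino}, IsTilingOn S t → IsTilingOn T u →
      Disjoint S T → ∀ c ∈ S, ∃! d, d ∈ t ∪ u ∧ c ∈ d.cubes := by
    intro S T t u ht hu hST c hc
    obtain ⟨d, ⟨hd, hcd⟩, hq⟩ := ht.2 c hc
    refine ⟨d, ⟨Finset.mem_union_left _ hd, hcd⟩, ?_⟩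
    rintro d' ⟨hd', hc'⟩
    rcases Finset.mem_union.1 hd' with h | h
    · exact hq d' ⟨h, hc'⟩
    · exact absurd (hu.1 d' h hc') (Set.disjoint_left.1 hST hc)
  constructor
  · intro d hd
    rcases Finset.mem_union.1 hd with h | h
    · exact (ht.1 d h).trans Set.subset_union_left
    · exact (hu.1 d h).trans Set.subset_union_right
  · rintro c (hc | hc)
    · exact key ht hu hST c hc
    · rw [Finset.union_comm]
      exact key hu ht hST.symm c hc

open Classical in
-- Cubes with different x-coordinates never share a vertical column, so all mixed effects vanish.
theorem pretwist_union {S T : Set Cube} {t u : Finset Domino} (ht : IsTilingOn S t)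
    (hu : IsTilingOn T u) (hST : ∀ a ∈ S, ∀ b ∈ T, a 0 ≠ b 0) :
    pretwist (basisVec 2) (t ∪ u) = pretwist (basisVec 2) t + pretwist (basisVec 2) u := by
  have hd : Disjoint t u := by
    rw [Finset.disjoint_left]
    intro d h h'
    exact hST d.white (ht.1 d h (Or.inl rfl)) d.white (hu.1 d h' (Or.inl rfl)) rfl
  have h0 : ∀ a b : Cube, a 0 ≠ b 0 → above 2 a b = 0 := by
    intro a b h
    by_contra hne
    exact h (above_ne_zero.1 hne).2.1
  have h1 : ∀ d ∈ t, ∀ d' ∈ u, effect (basisVec 2) d d' = 0 ∧ effect (basisVec 2) d' d = 0 := by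
    intro d hd d' hd'
    have k : ∀ a ∈ d.cubes, ∀ b ∈ d'.cubes, above 2 a b = 0 ∧ above 2 b a = 0 := fun a ha b hb =>
      ⟨h0 _ _ (hST a (ht.1 d hd ha) b (hu.1 d' hd' hb)),
        h0 _ _ (hST a (ht.1 d hd ha) b (hu.1 d' hd' hb)).symm⟩
    have mw : ∀ d : Domino, d.white ∈ d.cubes := fun d => Or.inl rfl
    have mb : ∀ d : Domino, d.black ∈ d.cubes := fun d => Or.inr rfl
    rw [effect_basisVec, effect_basisVec, aboveCount, aboveCount]
    simp [k _ (mw d) _ (mw d'), k _ (mw d) _ (mb d'), k _ (mb d) _ (mw d'), k _ (mb d) _ (mb d')]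
  unfold pretwist
  rw [Finset.sum_union hd]
  congr 1
  · refine Finset.sum_congr rfl fun d hd' => ?_
    rw [Finset.sum_union hd, add_eq_left]
    exact Finset.sum_eq_zero fun d' h' => (h1 d hd' d' h').1
  · refine Finset.sum_congr rfl fun d hd' => ?_
    rw [Finset.sum_union hd, add_eq_right]
    exact Finset.sum_eq_zero fun d' h' => (h1 d' h' d hd').2

theorem colour_eq_of_mod {c : Cube} {c' : Cube} (h : (c 0 + c 1 + c 2) % 2 = (c' 0 + c' 1 + c' 2) % 2) :
    colour c = colour c' := by
  unfold colour
  simp only [isWhite_iff, h]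

theorem colour_eq_neg_of_mod {c : Cube} {c' : Cube}
    (h : (c 0 + c 1 + c 2) % 2 ≠ (c' 0 + c' 1 + c' 2) % 2) : colour c = - colour c' := by
  unfold colour
  simp only [isWhite_iff]
  split_ifs <;> omega

theorem isRigid_translate (i : Fin 3) (v : Cube) : IsRigid i (fun c => c + v) where
  injective := add_left_injective v
  shareFace a b h := by rw [shareFace_iff] at *; simpa using h
  colour := by
    rcases Int.emod_two_eq_zero_or_one (v 0 + v 1 + v 2) with h | h
    · refine ⟨1, rfl, fun c => ?_⟩
      rw [one_mul]; apply colour_eq_of_mod; simp only [Pi.add_apply]; omega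
    · refine ⟨-1, rfl, fun c => ?_⟩
      rw [neg_one_mul]; apply colour_eq_neg_of_mod; simp only [Pi.add_apply]; omega
  above a b := by simp [above, ltn, dlt]
  cross a b a' b' := by simp

theorem dlt_sub_sub (m a b : ℤ) : dlt (m - a) (m - b) = dlt a b := by
  unfold dlt; split_ifs <;> omega

/-- A quarter turn is used because a plain exchange of coordinates would negate the cross product.
-/
theorem isRigid_rotate_two (m : ℤ) : IsRigid 2 (fun c => ![m - c 1, c 0, c 2]) where
  injective a b h := by
    have h0 := congrFun h 0
    have h1 := congrFun h 1
    have h2 := congrFun h 2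
    simp only [Matrix.cons_val] at h0 h1 h2
    ext j; fin_cases j <;> simp <;> omega
  shareFace a b h := by rw [shareFace_iff] at *; simp only [Matrix.cons_val]; omega
  colour := by
    rcases Int.emod_two_eq_zero_or_one m with h | h
    · refine ⟨1, rfl, fun c => ?_⟩
      rw [one_mul]; apply colour_eq_of_mod; simp only [Matrix.cons_val]; omega
    · refine ⟨-1, rfl, fun c => ?_⟩
      rw [neg_one_mul]; apply colour_eq_neg_of_mod; simp only [Matrix.cons_val]; omega
  above a b := by
    change ltn (a 2) (b 2) * (dlt (m - a 1) (m - b 1) * dlt (a 0) (b 0)) =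
      ltn (a 2) (b 2) * (dlt (a 0) (b 0) * dlt (a 1) (b 1))
    rw [dlt_sub_sub, mul_comm (dlt (a 1) _)]
  cross a b a' b' := by
    simp [cross]; ring

theorem isRigid_rotate_zero (m : ℤ) : IsRigid 0 (fun c => ![c 0, m - c 2, c 1]) where
  injective a b h := by
    have h0 := congrFun h 0
    have h1 := congrFun h 1
    have h2 := congrFun h 2
    simp only [Matrix.cons_val] at h0 h1 h2
    ext j; fin_cases j <;> simp <;> omega
  shareFace a b h := by rw [shareFace_iff] at *; simp only [Matrix.cons_val]; omega
  colour := by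
    rcases Int.emod_two_eq_zero_or_one m with h | h
    · refine ⟨1, rfl, fun c => ?_⟩
      rw [one_mul]; apply colour_eq_of_mod; simp only [Matrix.cons_val]; omega
    · refine ⟨-1, rfl, fun c => ?_⟩
      rw [neg_one_mul]; apply colour_eq_neg_of_mod; simp only [Matrix.cons_val]; omega
  above a b := by
    change ltn (a 0) (b 0) * (dlt (m - a 2) (m - b 2) * dlt (a 1) (b 1)) =
      ltn (a 0) (b 0) * (dlt (a 1) (b 1) * dlt (a 2) (b 2))
    rw [dlt_sub_sub, mul_comm (dlt (a 2) _)]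
  cross a b a' b' := by
    simp [cross]; ring

theorem twistSet_rotate_two {L M N : ℕ} {r : ℝ} (h : r ∈ twistSet L M N) :
    r ∈ twistSet M L N := by
  classical
  obtain ⟨t, ht, rfl⟩ := h
  have hr := isRigid_rotate_two ((M : ℤ) - 1)
  refine ⟨_, ?_, hr.pretwist_image t⟩
  have := IsTilingOn.image (S := box L M N) ht hr.injective hr.shareFace
  suffices hb : box M L N = (fun c : Cube => ![(M : ℤ) - 1 - c 1, c 0, c 2]) '' box L M N by
    rw [← hb] at this; exact this
  ext c
  constructor
  · intro hc
    obtain ⟨⟨h0, h0'⟩, ⟨h1, h1'⟩, ⟨h2, h2'⟩⟩ := hc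
    refine ⟨![c 1, (M : ℤ) - 1 - c 0, c 2], ?_, ?_⟩
    · simp only [box, Set.mem_ofPred_eq, Matrix.cons_val]; omega
    · ext j; fin_cases j <;> simp
  · rintro ⟨c, ⟨⟨h0, h0'⟩, ⟨h1, h1'⟩, ⟨h2, h2'⟩⟩, rfl⟩
    simp only [box, Set.mem_ofPred_eq, Matrix.cons_val]; omega

/-- A turn about e_x visibly preserves only the pretwist along e_x; the equality of the pretwists
transfers this to the twist. -/
theorem twistSet_rotate_zero {L M N : ℕ} {r : ℝ} (h : r ∈ twistSet L M N) :
    r ∈ twistSet L N M := by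
  classical
  obtain ⟨t, ht, rfl⟩ := h
  have hr := isRigid_rotate_zero ((N : ℤ) - 1)
  have h1 : IsTiling L N M (t.image (Domino.map _ hr.shareFace)) := by
    have := IsTilingOn.image (S := box L M N) ht hr.injective hr.shareFace
    suffices hb : box L N M = (fun c : Cube => ![c 0, (N : ℤ) - 1 - c 2, c 1]) '' box L M N by
      rw [← hb] at this; exact this
    ext c
    constructor
    · intro hc
      obtain ⟨⟨h0, h0'⟩, ⟨h1, h1'⟩, ⟨h2, h2'⟩⟩ := hc
      refine ⟨![c 0, c 2, (N : ℤ) - 1 - c 1], ?_, ?_⟩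
      · simp only [box, Set.mem_ofPred_eq, Matrix.cons_val]; omega
      · ext j; fin_cases j <;> simp
    · rintro ⟨c, ⟨⟨h0, h0'⟩, ⟨h1, h1'⟩, ⟨h2, h2'⟩⟩, rfl⟩
      simp only [box, Set.mem_ofPred_eq, Matrix.cons_val]; omega
  refine ⟨_, h1, ?_⟩
  rw [← h1.pretwist_eq_twist 0, ← ht.pretwist_eq_twist 0]
  exact hr.pretwist_image t

theorem twistSet_glue {L L' M N : ℕ} {r s : ℝ} (h : r ∈ twistSet L M N)
    (h' : s ∈ twistSet L' M N) : r + s ∈ twistSet (L + L') M N := by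
  classical
  obtain ⟨t, ht, rfl⟩ := h
  obtain ⟨u, hu, rfl⟩ := h'
  have hr := fun i => isRigid_translate i (Pi.single 0 (L : ℤ))
  have ht' : IsTilingOn (box L M N) t := ht
  have hu' := IsTilingOn.image (S := box L' M N) hu (hr 2).injective (hr 2).shareFace
  have hsep : ∀ a ∈ box L M N, ∀ b ∈ (fun c : Cube => c + Pi.single 0 (L : ℤ)) '' box L' M N,
      a 0 ≠ b 0 := by
    rintro a ⟨⟨h0, h0'⟩, -⟩ _ ⟨b, ⟨⟨h1, h1'⟩, -⟩, rfl⟩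
    simp only [Pi.add_apply, Pi.single_eq_same]
    omega
  refine ⟨t ∪ u.image (Domino.map _ (hr 2).shareFace), ?_, ?_⟩
  · have := ht'.union hu' (Set.disjoint_left.2 fun a ha hb => hsep a ha a hb rfl)
    suffices hb : box (L + L') M N =
        box L M N ∪ (fun c : Cube => c + Pi.single 0 (L : ℤ)) '' box L' M N by
      rw [← hb] at this; exact this
    ext c
    constructor
    · rintro ⟨⟨h0, h0'⟩, ⟨h1, h1'⟩, ⟨h2, h2'⟩⟩
      by_cases hc : c 0 < L
      · exact Or.inl ⟨⟨h0, hc⟩, ⟨h1, h1'⟩, ⟨h2, h2'⟩⟩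
      · refine Or.inr ⟨c - Pi.single 0 (L : ℤ), ?_, by simp⟩
        simp only [box, Set.mem_ofPred_eq, Pi.sub_apply, Pi.single_eq_same, ne_eq, one_ne_zero,
          not_false_eq_true, Pi.single_eq_of_ne, Fin.reduceEq]
        push_cast at h0'
        omega
    · rintro (⟨⟨h0, h0'⟩, ⟨h1, h1'⟩, ⟨h2, h2'⟩⟩ | ⟨c, ⟨⟨h0, h0'⟩, ⟨h1, h1'⟩, ⟨h2, h2'⟩⟩, rfl⟩)
      · refine ⟨⟨h0, ?_⟩, ⟨h1, h1'⟩, ⟨h2, h2'⟩⟩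
        push_cast; omega
      · simp only [box, Set.mem_ofPred_eq, Pi.add_apply, Pi.single_eq_same, ne_eq, one_ne_zero,
          not_false_eq_true, Pi.single_eq_of_ne, Fin.reduceEq]
        push_cast
        omega
  · unfold twist
    rw [pretwist_union ht' hu' hsep, (hr 2).pretwist_image]

/-! ### Tilings given by an involution -/

/-- `p` pairs each cube of `S` with an adjacent cube of `S`. -/
structure IsMatching (S : Set Cube) (p : Cube → Cube) : Prop where
  mem : ∀ c ∈ S, p c ∈ S
  invol : ∀ c ∈ S, p (p c) = c
  share : ∀ c ∈ S, ShareFace c (p c)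

/-- The vector of the domino formed by `c` and `p c`. -/
noncomputable def field (p : Cube → Cube) (c : Cube) : Fin 3 → ℤ := colour c • (p c - c)

open Classical in
/-- The domino formed by `c` and `p c`. -/
noncomputable def dominoOf (p : Cube → Cube) (c : Cube) : Domino :=
  if h : ShareFace c (p c) then
    if h' : IsWhite c then ⟨c, p c, h', h⟩
    else ⟨p c, c, not_not.1 (mt h.isWhite_iff.2 h'), h.symm⟩
  else ⟨0, Pi.single 0 1, by simp [IsWhite], ⟨0, Or.inl (by simp)⟩⟩

theorem dominoOf_cubes {p : Cube → Cube} {c : Cube} (h : ShareFace c (p c)) :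
    (dominoOf p c).cubes = {c, p c} := by
  unfold dominoOf Domino.cubes
  rw [dif_pos h]
  split_ifs
  · rfl
  · exact Set.pair_comm _ _

theorem dominoOf_vec {p : Cube → Cube} {c : Cube} (h : ShareFace c (p c)) :
    (dominoOf p c).vec = field p c := by
  unfold dominoOf Domino.vec field colour
  rw [dif_pos h]
  split_ifs <;> simp

/-- The sum of the effects along a column of height `N` with horizontal field `(f, g)`. -/
def columnSum (N : ℕ) (f g : ℕ → ℤ) : ℤ :=
  ∑ z ∈ Finset.range N, ∑ z' ∈ Finset.range N, ltn z z' * (f z' * g z - g z' * f z)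

theorem sum_range_dlt_mul {n : ℕ} {x : ℕ} (hx : x ∈ Finset.range n) (f : ℕ → ℤ) :
    ∑ x' ∈ Finset.range n, dlt x x' * f x' = f x := by
  have : ∀ x' ∈ Finset.range n, dlt x x' * f x' = if x = x' then f x' else 0 := by
    intro x' _
    unfold dlt
    by_cases h : x = x'
    · simp [h]
    · rw [if_neg (by exact_mod_cast h), if_neg h, zero_mul]
  rw [Finset.sum_congr rfl this, Finset.sum_ite_eq, if_pos hx]

theorem exists_tiling_of_isMatching {L M N : ℕ} {p : Cube → Cube}
    (h : IsMatching (box L M N) p) : ∃ t : Finset Domino, IsTiling L M N t ∧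
      twist t = (1 / 4 : ℝ) * ((∑ x ∈ Finset.range L, ∑ y ∈ Finset.range M,
        columnSum N (fun z => field p ![(x : ℤ), (y : ℤ), (z : ℤ)] 0)
          (fun z => field p ![(x : ℤ), (y : ℤ), (z : ℤ)] 1) : ℤ) : ℝ) := by
  classical
  have hc := fun c hc => dominoOf_cubes (h.share c hc)
  have hself : ∀ c ∈ box L M N, c ∈ (dominoOf p c).cubes := fun c hb => by
    rw [hc c hb]; exact Or.inl rfl
  have ht : IsTiling L M N ((boxCubes L M N).image (dominoOf p)) := by
    constructor
    · intro d hd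
      obtain ⟨c, hb, rfl⟩ := Finset.mem_image.1 hd
      rw [mem_boxCubes] at hb
      rw [hc c hb]
      rintro _ (rfl | rfl)
      · exact hb
      · exact h.mem c hb
    · intro c hb
      refine ⟨dominoOf p c, ⟨Finset.mem_image_of_mem _ (mem_boxCubes.2 hb), hself c hb⟩, ?_⟩
      rintro d ⟨hd, hcd⟩
      obtain ⟨c', hb', rfl⟩ := Finset.mem_image.1 hd
      rw [mem_boxCubes] at hb'
      apply Domino.eq_of_cubes_eq
      rw [hc c' hb'] at hcd
      rw [hc c' hb', hc c hb]
      rcases hcd with rfl | rfl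
      · rfl
      · rw [h.invol c' hb', Set.pair_comm]
  refine ⟨_, ht, ?_⟩
  have hD : ∀ c ∈ box L M N, dominoOf p c ∈ (boxCubes L M N).image (dominoOf p) ∧
      c ∈ (dominoOf p c).cubes := fun c hb =>
    ⟨Finset.mem_image_of_mem _ (mem_boxCubes.2 hb), hself c hb⟩
  unfold twist
  rw [pretwist_eq_sum_cubes ht hD 2]
  congr 2
  have e : ∑ c ∈ boxCubes L M N, ∑ c' ∈ boxCubes L M N,
      above 2 c c' * cross 2 (dominoOf p c').vec (dominoOf p c).vec =
      ∑ c ∈ boxCubes L M N, ∑ c' ∈ boxCubes L M N,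
        above 2 c c' * cross 2 (field p c') (field p c) := by
    refine Finset.sum_congr rfl fun c h1 => Finset.sum_congr rfl fun c' h2 => ?_
    rw [dominoOf_vec (h.share c (mem_boxCubes.1 h1)), dominoOf_vec (h.share c' (mem_boxCubes.1 h2))]
  rw [e, sum_boxCubes]
  refine Finset.sum_congr rfl fun x hx => Finset.sum_congr rfl fun y hy =>
    Finset.sum_congr rfl fun z _ => ?_
  rw [sum_boxCubes]
  have e2 : ∀ x' y' z' : ℕ, above 2 ![(x : ℤ), (y : ℤ), (z : ℤ)] ![(x' : ℤ), (y' : ℤ), (z' : ℤ)] *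
      cross 2 (field p ![(x' : ℤ), (y' : ℤ), (z' : ℤ)]) (field p ![(x : ℤ), (y : ℤ), (z : ℤ)]) =
      dlt x x' * (dlt y y' * (ltn z z' *
        cross 2 (field p ![(x' : ℤ), (y' : ℤ), (z' : ℤ)])
          (field p ![(x : ℤ), (y : ℤ), (z : ℤ)]))) := by
    intro x' y' z'
    change ltn z z' * (dlt x x' * dlt y y') * _ = _
    ring
  simp only [e2, ← Finset.mul_sum]
  rw [sum_range_dlt_mul hx (fun x' => ∑ y' ∈ Finset.range M, dlt y y' *
    ∑ z' ∈ Finset.range N, ltn z z' * cross 2 (field p ![(x' : ℤ), (y' : ℤ), (z' : ℤ)])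
      (field p ![(x : ℤ), (y : ℤ), (z : ℤ)])),
    sum_range_dlt_mul hy (fun y' => ∑ z' ∈ Finset.range N, ltn z z' *
      cross 2 (field p ![(x : ℤ), (y' : ℤ), (z' : ℤ)]) (field p ![(x : ℤ), (y : ℤ), (z : ℤ)]))]
  rfl

/-! ### Concentric rings -/

/-- The cells of `[0, P) × [0, Q)` at depth less than `D`. -/
def InRing (D P Q s t : ℤ) : Prop :=
  (0 ≤ s ∧ s < P ∧ 0 ≤ t ∧ t < Q) ∧ (s < D ∨ P - D ≤ s ∨ t < D ∨ Q - D ≤ t)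

/-- The step along the concentric rings of the rectangle `[0, P) × [0, Q)`, which are oriented
counterclockwise: forward if `n` is even and backward if `n` is odd. -/
def ringStep (P Q s t n : ℤ) : ℤ × ℤ :=
  -- Inequalities that are strict in one branch are weak in the other: a corner cell takes its
  -- outgoing side when stepping forward and its incoming side when stepping backward.
  if n % 2 = 0 then
    if t ≤ s ∧ s + t < P - 1 ∧ 2 * t < Q - 1 then (1, 0)
    else if P - 1 ≤ s + t ∧ P - s < Q - t ∧ P - 1 < 2 * s then (0, 1)
    else if Q - t ≤ P - s ∧ Q - 1 < s + t ∧ Q - 1 < 2 * t then (-1, 0)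
    else (0, -1)
  else
    if t < s ∧ s + t ≤ P - 1 ∧ 2 * t < Q - 1 then (-1, 0)
    else if P - 1 < s + t ∧ P - s ≤ Q - t ∧ P - 1 < 2 * s then (0, -1)
    else if Q - t < P - s ∧ Q - 1 ≤ s + t ∧ Q - 1 < 2 * t then (1, 0)
    else (0, 1)

theorem ringStep_cases (P Q s t n : ℤ) : ringStep P Q s t n = (1, 0) ∨
    ringStep P Q s t n = (-1, 0) ∨ ringStep P Q s t n = (0, 1) ∨ ringStep P Q s t n = (0, -1) := by
  unfold ringStep; split_ifs <;> simp

theorem inRing_ringStep {D P Q s t : ℤ} (hP : 2 * D ≤ P) (hQ : 2 * D ≤ Q)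
    (h : InRing D P Q s t) (n : ℤ) :
    InRing D P Q (s + (ringStep P Q s t n).1) (t + (ringStep P Q s t n).2) := by
  unfold InRing at *
  unfold ringStep
  split_ifs <;> dsimp only <;> omega

theorem ringStep_ringStep {D P Q s t : ℤ} (hP : 2 * D ≤ P) (hQ : 2 * D ≤ Q)
    (h : InRing D P Q s t) {n m : ℤ} (hm : (m - n) % 2 = 1) :
    ringStep P Q (s + (ringStep P Q s t n).1) (t + (ringStep P Q s t n).2) m =
      (-(ringStep P Q s t n).1, -(ringStep P Q s t n).2) := by
  unfold InRing at h
  rcases Int.emod_two_eq_zero_or_one n with hn | hn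
  · have hm' : ¬ m % 2 = 0 := by omega
    simp only [ringStep, hn, hm', if_true, if_false]
    repeat' split
    all_goals first | rfl | omega
  · have hm' : m % 2 = 0 := by omega
    have hn' : ¬ n % 2 = 0 := by omega
    simp only [ringStep, hn', hm', if_true, if_false]
    repeat' split
    all_goals first | rfl | omega

/-- A reflection reverses the orientation of the rings, so it exchanges forward and backward steps.
-/
theorem ringStep_reflect {D P Q s t : ℤ} (hP : 2 * D ≤ P) (hQ : 2 * D ≤ Q)
    (h : InRing D P Q s t) {n m : ℤ} (hm : (m - n) % 2 = 1) :
    ringStep P Q (P - 1 - s) t m = (-(ringStep P Q s t n).1, (ringStep P Q s t n).2) := by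
  unfold InRing at h
  unfold ringStep
  split_ifs <;> first | rfl | (exfalso; omega)

/-! ### Two rings linked by a loop -/

theorem IsMatching.piecewise {S : Set Cube} {R : Cube → Prop} [DecidablePred R] {p q : Cube → Cube}
    (hp : IsMatching {c | c ∈ S ∧ R c} p) (hq : IsMatching {c | c ∈ S ∧ ¬ R c} q) :
    IsMatching S (fun c => if R c then p c else q c) where
  mem c hc := by
    by_cases h : R c
    · simpa [h] using (hp.mem c ⟨hc, h⟩).1
    · simpa [h] using (hq.mem c ⟨hc, h⟩).1
  invol c hc := by
    by_cases h : R c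
    · simpa [h, (hp.mem c ⟨hc, h⟩).2] using hp.invol c ⟨hc, h⟩
    · simpa [h, (hq.mem c ⟨hc, h⟩).2] using hq.invol c ⟨hc, h⟩
  share c hc := by
    by_cases h : R c
    · simpa [h] using hp.share c ⟨hc, h⟩
    · simpa [h] using hq.share c ⟨hc, h⟩

theorem IsMatching.congr_set {S T : Set Cube} {p : Cube → Cube} (h : IsMatching S p)
    (hST : ∀ c, c ∈ T ↔ c ∈ S) : IsMatching T p := by
  have : T = S := Set.ext hST
  rwa [this]

/-- The rings of the rectangle `[o, o + P) × [0, Q)` in planes parallel to the `xy`-plane. -/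
def ringXY (o P Q κ : ℤ) (c : Cube) : Cube :=
  ![c 0 + (ringStep P Q (c 0 - o) (c 1) (c 0 + c 1 + c 2 + κ)).1,
    c 1 + (ringStep P Q (c 0 - o) (c 1) (c 0 + c 1 + c 2 + κ)).2, c 2]

/-- The rings of the rectangle `[o, o + P) × [0, Q)` in planes parallel to the `xz`-plane. -/
def ringXZ (o P Q κ : ℤ) (c : Cube) : Cube :=
  ![c 0 + (ringStep P Q (c 0 - o) (c 2) (c 0 + c 1 + c 2 + κ)).1, c 1,
    c 2 + (ringStep P Q (c 0 - o) (c 2) (c 0 + c 1 + c 2 + κ)).2]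

theorem isMatching_ringXY {D P Q : ℤ} (hP : 2 * D ≤ P) (hQ : 2 * D ≤ Q) (o κ : ℤ) (W : ℤ → Prop) :
    IsMatching {c | InRing D P Q (c 0 - o) (c 1) ∧ W (c 2)} (ringXY o P Q κ) where
  mem c hc := by
    refine ⟨?_, hc.2⟩
    have := inRing_ringStep hP hQ hc.1 (c 0 + c 1 + c 2 + κ)
    simp only [ringXY, Matrix.cons_val]
    rwa [add_sub_right_comm]
  invol c hc := by
    -- A step changes the coordinate sum by one, hence its parity, so the next step goes back.
    have h1 := ringStep_ringStep hP hQ hc.1 (n := c 0 + c 1 + c 2 + κ)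
      (m := c 0 + (ringStep P Q (c 0 - o) (c 1) (c 0 + c 1 + c 2 + κ)).1 +
        (c 1 + (ringStep P Q (c 0 - o) (c 1) (c 0 + c 1 + c 2 + κ)).2) + c 2 + κ) (by
        rcases ringStep_cases P Q (c 0 - o) (c 1) (c 0 + c 1 + c 2 + κ) with h | h | h | h <;>
          rw [h] <;> dsimp only <;> omega)
    rw [← add_sub_right_comm] at h1
    ext j
    fin_cases j <;> simp [ringXY, h1]
  share c hc := by
    rw [shareFace_iff]
    simp only [ringXY, Matrix.cons_val]
    rcases ringStep_cases P Q (c 0 - o) (c 1) (c 0 + c 1 + c 2 + κ) with h | h | h | h <;>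
      simp [h]

theorem isMatching_ringXZ {D P Q : ℤ} (hP : 2 * D ≤ P) (hQ : 2 * D ≤ Q) (o κ : ℤ) (W : ℤ → Prop) :
    IsMatching {c | InRing D P Q (c 0 - o) (c 2) ∧ W (c 1)} (ringXZ o P Q κ) where
  mem c hc := by
    refine ⟨?_, hc.2⟩
    have := inRing_ringStep hP hQ hc.1 (c 0 + c 1 + c 2 + κ)
    simp only [ringXZ, Matrix.cons_val]
    rwa [add_sub_right_comm]
  invol c hc := by
    have h1 := ringStep_ringStep hP hQ hc.1 (n := c 0 + c 1 + c 2 + κ)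
      (m := c 0 + (ringStep P Q (c 0 - o) (c 2) (c 0 + c 1 + c 2 + κ)).1 + c 1 +
        (c 2 + (ringStep P Q (c 0 - o) (c 2) (c 0 + c 1 + c 2 + κ)).2) + κ) (by
        rcases ringStep_cases P Q (c 0 - o) (c 2) (c 0 + c 1 + c 2 + κ) with h | h | h | h <;>
          rw [h] <;> dsimp only <;> omega)
    rw [← add_sub_right_comm] at h1
    ext j
    fin_cases j <;> simp [ringXZ, h1]
  share c hc := by
    rw [shareFace_iff]
    simp only [ringXZ, Matrix.cons_val]
    rcases ringStep_cases P Q (c 0 - o) (c 2) (c 0 + c 1 + c 2 + κ) with h | h | h | h <;>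
      simp [h]

/-- The cubes `c` with `w ≤ c 1 < B - w`. -/
def IsMid (w B : ℤ) (c : Cube) : Prop := w ≤ c 1 ∧ c 1 < B - w

/-- The cubes of the loop that passes through the two rings. -/
def InLoop (a w B H : ℤ) (c : Cube) : Prop :=
  (a ≤ c 2 ∧ c 2 < H - a ∧ a ≤ c 0 ∧ c 0 < 3 * a + 2 * w) ∧
    (¬ IsMid w B c ∨ c 0 < a + w ∨ 3 * a + w ≤ c 0)

instance (w B : ℤ) : DecidablePred (IsMid w B) := fun _ => inferInstanceAs (Decidable (_ ∧ _))

instance (a w B H : ℤ) : DecidablePred (InLoop a w B H) := fun _ =>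
  inferInstanceAs (Decidable (_ ∧ _))

/-- The tiling of the `(4a + 2w) × B × H` box that consists of two stacks of concentric rings,
linked by a third one that passes through both holes, and closed up at both ends. -/
def linkedRings (a w B H : ℤ) (c : Cube) : Cube :=
  if InLoop a w B H c then ringXY a (2 * a + 2 * w) B 0 c
  else if IsMid w B c then
    if c 0 < 2 * a + w then ringXZ 0 (2 * a + w) H 0 c
    -- The phase 1 reverses the field of the second stack of rings. The loop's right arm is directed
    -- opposite to its left arm, so both links contribute with the same sign.
    else ringXZ (2 * a + w) (2 * a + w) H 1 c
  else ringXZ 0 (4 * a + 2 * w) H 0 c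

theorem isMatching_linkedRings {a w B H : ℕ} (hB : 2 * w ≤ B) (hH : 2 * a ≤ H) :
    IsMatching (box (4 * a + 2 * w) B H) (linkedRings a w B H) := by
  refine IsMatching.piecewise ?_ (IsMatching.piecewise (IsMatching.piecewise ?_ ?_) ?_)
  · refine (isMatching_ringXY (D := w) (P := 2 * a + 2 * w) (Q := B) (by omega) (by omega) a 0
      (fun z => a ≤ z ∧ z < (H : ℤ) - a)).congr_set fun c => ?_
    simp only [Set.mem_ofPred_eq, box, InRing, InLoop, IsMid]
    push_cast
    constructor <;> intro h <;> omega
  · refine (isMatching_ringXZ (D := a) (P := 2 * a + w) (Q := H) (by omega) (by omega) 0 0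
      (fun y => w ≤ y ∧ y < (B : ℤ) - w)).congr_set fun c => ?_
    simp only [Set.mem_ofPred_eq, box, InRing, InLoop, IsMid]
    push_cast
    constructor <;> intro h <;> omega
  · refine (isMatching_ringXZ (D := a) (P := 2 * a + w) (Q := H) (by omega) (by omega) (2 * a + w) 1
      (fun y => w ≤ y ∧ y < (B : ℤ) - w)).congr_set fun c => ?_
    simp only [Set.mem_ofPred_eq, box, InRing, InLoop, IsMid]
    push_cast
    constructor <;> intro h <;> omega
  · refine (isMatching_ringXZ (D := a) (P := 4 * a + 2 * w) (Q := H) (by omega) (by omega) 0 0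
      (fun y => (0 ≤ y ∧ y < w) ∨ ((B : ℤ) - w ≤ y ∧ y < B))).congr_set fun c => ?_
    simp only [Set.mem_ofPred_eq, box, InRing, InLoop, IsMid]
    push_cast
    constructor <;> intro h <;> omega

/-! ### The twist of the linked rings, column by column -/

theorem columnSum_eq_zero {N : ℕ} {f g : ℕ → ℤ} (h : ∀ z < N, g z = 0) : columnSum N f g = 0 := by
  refine Finset.sum_eq_zero fun z hz => Finset.sum_eq_zero fun z' hz' => ?_
  rw [h z (Finset.mem_range.1 hz), h z' (Finset.mem_range.1 hz')]; ring

theorem columnSum_neg {N : ℕ} {f g f' g' : ℕ → ℤ} (hf : ∀ z < N, f' z = f z)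
    (hg : ∀ z < N, g' z = - g z) : columnSum N f' g' = - columnSum N f g := by
  unfold columnSum
  rw [← Finset.sum_neg_distrib]
  refine Finset.sum_congr rfl fun z hz => ?_
  rw [← Finset.sum_neg_distrib]
  refine Finset.sum_congr rfl fun z' hz' => ?_
  rw [hf z (Finset.mem_range.1 hz), hg z (Finset.mem_range.1 hz), hf z' (Finset.mem_range.1 hz'),
    hg z' (Finset.mem_range.1 hz')]; ring

theorem sum_range_ite (N l u : ℕ) (hl : l ≤ u) (hu : u ≤ N) :
    ∑ z ∈ Finset.range N, (if l ≤ z ∧ z < u then (1 : ℤ) else 0) = u - l := by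
  have : (Finset.range N).filter (fun z => l ≤ z ∧ z < u) = Finset.Ico l u := by
    ext z; simp; omega
  rw [Finset.sum_boole, this, Nat.card_Ico]
  omega

/-- The pairs bottom–middle and middle–top each contribute a(H-2a); bottom and top are parallel. -/
theorem columnSum_three {H a : ℕ} (hH : 2 * a ≤ H) {f g : ℕ → ℤ} {σ : ℤ} (hσ : σ * σ = 1)
    (hf : ∀ z < H, f z = if z < a then σ else if z < H - a then 0 else -σ)
    (hg : ∀ z < H, g z = if z < a then 0 else if z < H - a then -σ else 0) :
    columnSum H f g = 2 * a * (H - 2 * a) := by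
  have e : ∀ z ∈ Finset.range H, ∀ z' ∈ Finset.range H, ltn z z' * (f z' * g z - g z' * f z) =
      (if a ≤ z ∧ z < H - a then (1 : ℤ) else 0) * (if H - a ≤ z' ∧ z' < H then 1 else 0) +
      (if 0 ≤ z ∧ z < a then (1 : ℤ) else 0) * (if a ≤ z' ∧ z' < H - a then 1 else 0) := by
    intro z hz z' hz'
    have h1 := Finset.mem_range.1 hz
    have h2 := Finset.mem_range.1 hz'
    rw [hf z h1, hg z h1, hf z' h2, hg z' h2]
    unfold ltn
    rcases lt_or_ge z a with h3 | h3 <;> rcases lt_or_ge z (H - a) with h4 | h4 <;>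
    rcases lt_or_ge z' a with h5 | h5 <;> rcases lt_or_ge z' (H - a) with h6 | h6 <;>
    first
    | omega
    | (simp [h2, h3, h4, h5, h6, not_lt.2, not_le.2, hσ] <;> omega)
  unfold columnSum
  rw [Finset.sum_congr rfl fun z hz => Finset.sum_congr rfl (e z hz)]
  simp only [Finset.sum_add_distrib, ← Finset.mul_sum, ← Finset.sum_mul]
  rw [sum_range_ite H a (H - a) (by omega) (by omega), sum_range_ite H (H - a) H (by omega) le_rfl,
    sum_range_ite H 0 a (by omega) (by omega)]
  push_cast [Nat.cast_sub (show a ≤ H by omega)]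
  ring

theorem colour_eq_ite (c : Cube) : colour c = if (c 0 + c 1 + c 2) % 2 = 0 then 1 else -1 := by
  unfold colour
  simp only [isWhite_iff]

theorem field_ringXY (o P Q κ : ℤ) (c : Cube) :
    (colour c • (ringXY o P Q κ c - c)) 0 =
      colour c * (ringStep P Q (c 0 - o) (c 1) (c 0 + c 1 + c 2 + κ)).1 ∧
    (colour c • (ringXY o P Q κ c - c)) 1 =
      colour c * (ringStep P Q (c 0 - o) (c 1) (c 0 + c 1 + c 2 + κ)).2 := by
  simp only [Pi.smul_apply, Pi.sub_apply, smul_eq_mul, ringXY, Matrix.cons_val,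
    add_sub_cancel_left, and_self]

theorem field_ringXZ (o P Q κ : ℤ) (c : Cube) :
    (colour c • (ringXZ o P Q κ c - c)) 0 =
      colour c * (ringStep P Q (c 0 - o) (c 2) (c 0 + c 1 + c 2 + κ)).1 ∧
    (colour c • (ringXZ o P Q κ c - c)) 1 = 0 := by
  simp only [Pi.smul_apply, Pi.sub_apply, smul_eq_mul, ringXZ, Matrix.cons_val,
    add_sub_cancel_left, sub_self, mul_zero, and_self]

/-- The field in the columns that run through the left arms of the loop and of the first ring. -/
theorem field_linkedRings_left {a w B H : ℕ} (hH : 2 * a ≤ H) (c : Cube)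
    (hy : IsMid w B c) (hx : a ≤ c 0 ∧ c 0 < a + w) (hz : 0 ≤ c 2 ∧ c 2 < H) :
    field (linkedRings a w B H) c 0 =
      (if c 2 < a then 1 else if c 2 < (H : ℤ) - a then 0 else -1) ∧
    field (linkedRings a w B H) c 1 =
      (if c 2 < a then 0 else if c 2 < (H : ℤ) - a then -1 else 0) := by
  have hy' := hy
  unfold IsMid at hy'
  by_cases hl : InLoop a w B H c
  · have hl' := hl
    unfold InLoop at hl'
    unfold field linkedRings
    rw [if_pos hl, (field_ringXY _ _ _ _ _).1, (field_ringXY _ _ _ _ _).2, colour_eq_ite]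
    unfold ringStep
    split_ifs <;> first | (exfalso; omega) | simp
  · have hl' := hl
    unfold InLoop at hl'
    unfold field linkedRings
    rw [if_neg hl, if_pos hy, if_pos (by omega), (field_ringXZ _ _ _ _ _).1,
      (field_ringXZ _ _ _ _ _).2, colour_eq_ite]
    unfold ringStep
    split_ifs <;> first | (exfalso; omega) | simp

/-- The field in the columns that run through the right arms of the loop and of the second ring. -/
theorem field_linkedRings_right {a w B H : ℕ} (hH : 2 * a ≤ H) (c : Cube)
    (hy : IsMid w B c) (hx : 3 * a + w ≤ c 0 ∧ c 0 < 3 * a + 2 * w) (hz : 0 ≤ c 2 ∧ c 2 < H) :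
    field (linkedRings a w B H) c 0 =
      (if c 2 < a then -1 else if c 2 < (H : ℤ) - a then 0 else 1) ∧
    field (linkedRings a w B H) c 1 =
      (if c 2 < a then 0 else if c 2 < (H : ℤ) - a then 1 else 0) := by
  have hy' := hy
  unfold IsMid at hy'
  by_cases hl : InLoop a w B H c
  · have hl' := hl
    unfold InLoop at hl'
    unfold field linkedRings
    rw [if_pos hl, (field_ringXY _ _ _ _ _).1, (field_ringXY _ _ _ _ _).2, colour_eq_ite]
    unfold ringStep
    split_ifs <;> first | (exfalso; omega) | simp
  · have hl' := hl
    unfold InLoop at hl'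
    unfold field linkedRings
    rw [if_neg hl, if_pos hy, if_neg (by omega), (field_ringXZ _ _ _ _ _).1,
      (field_ringXZ _ _ _ _ _).2, colour_eq_ite]
    unfold ringStep
    split_ifs <;> first | (exfalso; omega) | simp

theorem field_linkedRings_mid {a w B H : ℤ} (c : Cube)
    (hy : IsMid w B c) (hx : ¬ (a ≤ c 0 ∧ c 0 < a + w))
    (hx' : ¬ (3 * a + w ≤ c 0 ∧ c 0 < 3 * a + 2 * w)) :
    field (linkedRings a w B H) c 1 = 0 := by
  have hl : ¬ InLoop a w B H c := by
    unfold InLoop; intro h; have := h.2; have := h.1; tauto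
  unfold field linkedRings
  rw [if_neg hl, if_pos hy]
  split_ifs
  · exact (field_ringXZ _ _ _ _ _).2
  · exact (field_ringXZ _ _ _ _ _).2

/-- The end slabs are symmetric under reflection in x, up to the phase. As 4a+2w is even, the
reflection also swaps the colours, so the two column sums are opposite. -/
theorem field_linkedRings_end {a w B H : ℕ} (hB : 2 * w ≤ B) (hH : 2 * a ≤ H) (c c' : Cube)
    (hc : c ∈ box (4 * a + 2 * w) B H) (hy : ¬ IsMid w B c)
    (h0 : c' 0 = 4 * a + 2 * w - 1 - c 0) (h1 : c' 1 = c 1) (h2 : c' 2 = c 2) :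
    field (linkedRings a w B H) c' 0 = field (linkedRings a w B H) c 0 ∧
    field (linkedRings a w B H) c' 1 = - field (linkedRings a w B H) c 1 := by
  obtain ⟨⟨b0, b0'⟩, ⟨b1, b1'⟩, ⟨b2, b2'⟩⟩ := hc
  push_cast at b0'
  have hcol : colour c' = - colour c := colour_eq_neg_of_mod (by omega)
  have hy' : ¬ IsMid w B c' := by unfold IsMid at *; omega
  have hm : (c' 0 + c' 1 + c' 2 + 0 - (c 0 + c 1 + c 2 + 0)) % 2 = 1 := by omega
  by_cases hl : InLoop a w B H c
  · have hl' : InLoop a w B H c' := by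
      refine ⟨?_, Or.inl hy'⟩
      have := hl.1
      omega
    have hr : InRing w (2 * a + 2 * w) B (c 0 - a) (c 1) := by
      unfold InLoop IsMid at hl; unfold InRing; unfold IsMid at hy; omega
    have key := ringStep_reflect (by omega) (by omega) hr hm
    rw [show (2 : ℤ) * a + 2 * w - 1 - (c 0 - a) = c' 0 - a by omega, ← h1] at key
    unfold field linkedRings
    rw [if_pos hl, if_pos hl', (field_ringXY _ _ _ _ _).1, (field_ringXY _ _ _ _ _).2,
      (field_ringXY _ _ _ _ _).1, (field_ringXY _ _ _ _ _).2,
      ← h1, key, hcol]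
    simp
  · have hl' : ¬ InLoop a w B H c' := by
      intro h
      apply hl
      refine ⟨?_, Or.inl hy⟩
      have := h.1
      omega
    have hr : InRing a (4 * a + 2 * w) H (c 0 - 0) (c 2) := by
      unfold InLoop at hl; unfold InRing; simp only [hy, not_false_eq_true, true_or, and_true] at hl; omega
    have key := ringStep_reflect (by omega) (by omega) hr hm
    rw [show (4 : ℤ) * a + 2 * w - 1 - (c 0 - 0) = c' 0 - 0 by omega, ← h2] at key
    unfold field linkedRings
    rw [if_neg hl, if_neg hl', if_neg hy, if_neg hy', (field_ringXZ _ _ _ _ _).1,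
      (field_ringXZ _ _ _ _ _).2, (field_ringXZ _ _ _ _ _).1, (field_ringXZ _ _ _ _ _).2,
      ← h2, key, hcol]
    simp

theorem linkedRings_column {a w B H : ℕ} (hH : 2 * a ≤ H) {x y : ℕ}
    (hy : w ≤ y ∧ y < B - w) :
    columnSum H (fun z => field (linkedRings a w B H) ![(x : ℤ), (y : ℤ), (z : ℤ)] 0)
      (fun z => field (linkedRings a w B H) ![(x : ℤ), (y : ℤ), (z : ℤ)] 1) =
      ((if a ≤ x ∧ x < a + w then 1 else 0) +
        (if 3 * a + w ≤ x ∧ x < 3 * a + 2 * w then 1 else 0)) * (2 * a * (H - 2 * a)) := by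
  have hm : ∀ z : ℕ, IsMid w B ![(x : ℤ), (y : ℤ), (z : ℤ)] := by
    intro z; unfold IsMid; simp only [Matrix.cons_val]; omega
  by_cases h1 : a ≤ x ∧ x < a + w
  · rw [if_pos h1, if_neg (by omega)]
    have key := fun (z : ℕ) (hz : z < H) => field_linkedRings_left hH _ (hm z)
      (by simp only [Matrix.cons_val]; omega) (by simp only [Matrix.cons_val]; omega)
    simp only [Matrix.cons_val] at key
    rw [columnSum_three hH (σ := 1) rfl]
    · ring
    · intro z hz
      rw [(key z hz).1]
      split_ifs <;> omega
    · intro z hz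
      rw [(key z hz).2]
      split_ifs <;> omega
  · by_cases h2 : 3 * a + w ≤ x ∧ x < 3 * a + 2 * w
    · rw [if_neg h1, if_pos h2]
      have key := fun (z : ℕ) (hz : z < H) => field_linkedRings_right hH _ (hm z)
        (by simp only [Matrix.cons_val]; omega) (by simp only [Matrix.cons_val]; omega)
      simp only [Matrix.cons_val] at key
      rw [columnSum_three hH (σ := -1) rfl]
      · ring
      · intro z hz
        rw [(key z hz).1]
        split_ifs <;> omega
      · intro z hz
        rw [(key z hz).2]
        split_ifs <;> omega
    · rw [if_neg h1, if_neg h2, columnSum_eq_zero]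
      · ring
      · intro z _
        apply field_linkedRings_mid _ (hm z) <;> simp only [Matrix.cons_val] <;> omega

theorem linkedRings_column_end {a w B H : ℕ} (hB : 2 * w ≤ B) (hH : 2 * a ≤ H) {x y : ℕ}
    (hx : x < 4 * a + 2 * w) (hy : ¬ (w ≤ y ∧ y < B - w)) (hyB : y < B) :
    columnSum H
      (fun z => field (linkedRings a w B H) ![((4 * a + 2 * w - 1 - x : ℕ) : ℤ), (y : ℤ), (z : ℤ)] 0)
      (fun z => field (linkedRings a w B H) ![((4 * a + 2 * w - 1 - x : ℕ) : ℤ), (y : ℤ), (z : ℤ)] 1)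
    = - columnSum H (fun z => field (linkedRings a w B H) ![(x : ℤ), (y : ℤ), (z : ℤ)] 0)
      (fun z => field (linkedRings a w B H) ![(x : ℤ), (y : ℤ), (z : ℤ)] 1) := by
  have key := fun (z : ℕ) (hz : z < H) => field_linkedRings_end hB hH ![(x : ℤ), (y : ℤ), (z : ℤ)]
    ![((4 * a + 2 * w - 1 - x : ℕ) : ℤ), (y : ℤ), (z : ℤ)]
    (by simp only [box, Set.mem_ofPred_eq, Matrix.cons_val]; push_cast; omega)
    (by unfold IsMid; simp only [Matrix.cons_val]; omega)
    (by simp only [Matrix.cons_val]; omega) rfl rfl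
  exact columnSum_neg (fun z hz => (key z hz).1) (fun z hz => (key z hz).2)

theorem linkedRings_mem_twistSet {a w B H : ℕ} (hB : 2 * w ≤ B) (hH : 2 * a ≤ H) :
    (a : ℝ) * w * (B - 2 * w) * (H - 2 * a) ∈ twistSet (4 * a + 2 * w) B H := by
  obtain ⟨t, ht, htw⟩ := exists_tiling_of_isMatching (isMatching_linkedRings hB hH)
  refine ⟨t, ht, ?_⟩
  rw [htw, Finset.sum_comm]
  have key : ∀ y ∈ Finset.range B, ∑ x ∈ Finset.range (4 * a + 2 * w),
      columnSum H (fun z => field (linkedRings a w B H) ![(x : ℤ), (y : ℤ), (z : ℤ)] 0)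
        (fun z => field (linkedRings a w B H) ![(x : ℤ), (y : ℤ), (z : ℤ)] 1) =
      (if w ≤ y ∧ y < B - w then 1 else 0) * (2 * w * (2 * a * (H - 2 * a))) := by
    intro y hy
    by_cases h : w ≤ y ∧ y < B - w
    · rw [Finset.sum_congr rfl fun x _ => linkedRings_column hH h, ← Finset.sum_mul,
        Finset.sum_add_distrib, sum_range_ite _ _ _ (by omega) (by omega),
        sum_range_ite _ _ _ (by omega) (by omega), if_pos h]
      push_cast; ring
    · have h1 := Finset.sum_range_reflect (fun x : ℕ => columnSum H
        (fun z => field (linkedRings a w B H) ![(x : ℤ), (y : ℤ), (z : ℤ)] 0)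
        (fun z => field (linkedRings a w B H) ![(x : ℤ), (y : ℤ), (z : ℤ)] 1)) (4 * a + 2 * w)
      rw [Finset.sum_congr rfl fun x hx => linkedRings_column_end hB hH (Finset.mem_range.1 hx) h
        (Finset.mem_range.1 hy), Finset.sum_neg_distrib] at h1
      rw [if_neg h]
      omega
  rw [Finset.sum_congr rfl key, ← Finset.sum_mul, sum_range_ite _ _ _ (by omega) (by omega)]
  push_cast [Nat.cast_sub (show w ≤ B by omega)]
  ring

/-! ### Small tilings and calculus of maximal twists -/

/-- The tiling of the `3 × 3 × 2` box by two rings around a vertical domino. -/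
def smallRings (c : Cube) : Cube :=
  if c 0 = 1 ∧ c 1 = 1 then ![1, 1, 1 - c 2] else ringXY 0 3 3 0 c

theorem isMatching_smallRings : IsMatching (box 3 3 2) smallRings := by
  refine IsMatching.piecewise ⟨?_, ?_, ?_⟩ ?_
  · rintro c ⟨⟨⟨h0, h0'⟩, ⟨h1, h1'⟩, ⟨h2, h2'⟩⟩, h⟩
    refine ⟨?_, by simp⟩
    simp only [box, Set.mem_ofPred_eq, Matrix.cons_val] at h2' ⊢
    push_cast at h2' ⊢
    refine ⟨by norm_num, by norm_num, by omega, by omega⟩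
  · rintro c ⟨-, h0, h1⟩
    ext j
    fin_cases j <;> simp [h0, h1]
  · rintro c ⟨⟨⟨h0, h0'⟩, ⟨h1, h1'⟩, ⟨h2, h2'⟩⟩, h, h'⟩
    rw [shareFace_iff]
    simp only [Matrix.cons_val]
    push_cast at h2'
    omega
  · refine (isMatching_ringXY (D := 1) (P := 3) (Q := 3) (by omega) (by omega) 0 0
      (fun z => 0 ≤ z ∧ z < 2)).congr_set fun c => ?_
    simp only [Set.mem_ofPred_eq, box, InRing]
    push_cast
    constructor <;> intro h <;> omega

theorem one_mem_twistSet : (1 : ℝ) ∈ twistSet 3 3 2 := by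
  obtain ⟨t, ht, htw⟩ := exists_tiling_of_isMatching isMatching_smallRings
  refine ⟨t, ht, ?_⟩
  rw [htw]
  -- Each of the four corner columns contributes 1; in the others the field is parallel in both
  -- layers, or vertical.
  have : ∑ x ∈ Finset.range 3, ∑ y ∈ Finset.range 3,
      columnSum 2 (fun z => field smallRings ![(x : ℤ), (y : ℤ), (z : ℤ)] 0)
        (fun z => field smallRings ![(x : ℤ), (y : ℤ), (z : ℤ)] 1) = 4 := by
    unfold field
    simp only [colour_eq_ite]
    decide
  rw [this]; norm_num

/-- The tiling of a box of even length by dominoes parallel to `e_x`. -/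
def parallelX (c : Cube) : Cube := ![if c 0 % 2 = 0 then c 0 + 1 else c 0 - 1, c 1, c 2]

theorem isMatching_parallelX {L M N : ℕ} (hL : Even L) : IsMatching (box L M N) parallelX := by
  rw [Nat.even_iff] at hL
  refine ⟨?_, ?_, ?_⟩
  · rintro c ⟨⟨h0, h0'⟩, h1, h2⟩
    refine ⟨?_, h1, h2⟩
    simp only [parallelX, Matrix.cons_val]
    split_ifs <;> omega
  · intro c _
    ext j
    fin_cases j
    · simp only [parallelX, Matrix.cons_val, Fin.zero_eta]
      split_ifs <;> omega
    · rfl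
    · rfl
  · intro c _
    rw [shareFace_iff]
    simp only [parallelX, Matrix.cons_val]
    split_ifs <;> omega

theorem zero_mem_twistSet {L M N : ℕ} (h : Even L ∨ Even M ∨ Even N) : (0 : ℝ) ∈ twistSet L M N := by
  have key : ∀ {L M N : ℕ}, Even L → (0 : ℝ) ∈ twistSet L M N := by
    intro L M N hL
    obtain ⟨t, ht, htw⟩ := exists_tiling_of_isMatching (isMatching_parallelX (M := M) (N := N) hL)
    refine ⟨t, ht, ?_⟩
    rw [htw, Finset.sum_eq_zero, Int.cast_zero, mul_zero]
    refine fun x _ => Finset.sum_eq_zero fun y _ => columnSum_eq_zero fun z _ => ?_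
    simp [field, parallelX]
  rcases h with h | h | h
  · exact key h
  · exact twistSet_rotate_two (key h)
  · exact twistSet_rotate_zero (twistSet_rotate_two (key h))

/-! ### Monotonicity and superadditivity of the maximal twist -/

theorem le_maxTwist {L M N : ℕ} {r : ℝ} (h : r ∈ twistSet L M N) : r ≤ maxTwist L M N :=
  (isGreatest_maxTwist ⟨r, h⟩).2 h

theorem maxTwist_nonneg {L M N : ℕ} (h : Even L ∨ Even M ∨ Even N) : 0 ≤ maxTwist L M N :=
  le_maxTwist (zero_mem_twistSet h)

theorem maxTwist_mem {L M N : ℕ} (h : Even L ∨ Even M ∨ Even N) :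
    maxTwist L M N ∈ twistSet L M N :=
  (isGreatest_maxTwist ⟨0, zero_mem_twistSet h⟩).1

theorem maxTwist_swap_left (L M N : ℕ) : maxTwist M L N = maxTwist L M N := by
  unfold maxTwist
  congr 1
  exact Set.Subset.antisymm (fun _ => twistSet_rotate_two) fun _ => twistSet_rotate_two

theorem maxTwist_swap_right (L M N : ℕ) : maxTwist L N M = maxTwist L M N := by
  unfold maxTwist
  congr 1
  exact Set.Subset.antisymm (fun _ => twistSet_rotate_zero) fun _ => twistSet_rotate_zero

theorem maxTwist_rotate (L M N : ℕ) : maxTwist M N L = maxTwist L M N := by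
  rw [maxTwist_swap_right, maxTwist_swap_left]

theorem maxTwist_add_le {L L' M N : ℕ} (h : Even L ∨ Even M ∨ Even N)
    (h' : Even L' ∨ Even M ∨ Even N) :
    maxTwist L M N + maxTwist L' M N ≤ maxTwist (L + L') M N :=
  le_maxTwist (twistSet_glue (maxTwist_mem h) (maxTwist_mem h'))

/-- The parity conditions make the remaining slab tileable, and it can be filled with twist 0. -/
theorem maxTwist_mono {L L' M N : ℕ} (hL : L ≤ L') (h : Even L ∨ Even M ∨ Even N)
    (h' : Even L' ∨ Even M ∨ Even N) : maxTwist L M N ≤ maxTwist L' M N := by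
  have h2 : Even (L' - L) ∨ Even M ∨ Even N := by
    rcases h with h | h
    · rcases h' with h' | h'
      · exact Or.inl ((Nat.even_sub hL).2 ⟨fun _ => h, fun _ => h'⟩)
      · exact Or.inr h'
    · exact Or.inr h
  have := maxTwist_add_le h h2
  rw [Nat.add_sub_cancel' hL] at this
  linarith [maxTwist_nonneg h2]

theorem mul_maxTwist_le {L M N : ℕ} (h : Even L ∨ Even M ∨ Even N) (k : ℕ) :
    k * maxTwist L M N ≤ maxTwist (k * L) M N := by
  have hk : ∀ k : ℕ, Even (k * L) ∨ Even M ∨ Even N := fun k => h.imp_left fun h => h.mul_left k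
  induction k with
  | zero => simpa using maxTwist_nonneg (hk 0)
  | succ k ih =>
    have := maxTwist_add_le (hk k) h
    rw [Nat.succ_mul]
    push_cast
    linarith

theorem div_mul_maxTwist_le {k L M N : ℕ} (h : Even k ∨ Even M ∨ Even N)
    (h' : Even L ∨ Even M ∨ Even N) : (L / k : ℕ) * maxTwist k M N ≤ maxTwist L M N :=
  (mul_maxTwist_le h _).trans (maxTwist_mono (Nat.div_mul_le_self L k)
    (h.imp_left fun h => h.mul_left _) h')

/-- Blocks of `3 × 3 × 2` give a lower bound. -/
theorem blocks_le_maxTwist {P Q E : ℕ} (hE : Even E) :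
    ((E / 2 : ℕ) : ℝ) * (P / 3 : ℕ) * (Q / 3 : ℕ) ≤ maxTwist P Q E := by
  have h2 : Even 2 := even_two
  have h1 : (1 : ℝ) ≤ maxTwist 3 3 2 := le_maxTwist one_mem_twistSet
  have a1 : ((P / 3 : ℕ) : ℝ) * maxTwist 3 3 2 ≤ maxTwist P 3 2 :=
    div_mul_maxTwist_le (Or.inr (Or.inr h2)) (Or.inr (Or.inr h2))
  have a2 : ((Q / 3 : ℕ) : ℝ) * maxTwist 3 P 2 ≤ maxTwist Q P 2 :=
    div_mul_maxTwist_le (Or.inr (Or.inr h2)) (Or.inr (Or.inr h2))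
  have a3 : ((E / 2 : ℕ) : ℝ) * maxTwist 2 P Q ≤ maxTwist E P Q :=
    div_mul_maxTwist_le (Or.inl h2) (Or.inl hE)
  rw [maxTwist_swap_left P 3] at a2
  rw [← maxTwist_rotate 2 P Q, ← maxTwist_rotate E P Q] at a3
  rw [maxTwist_swap_left P Q 2] at a2
  calc ((E / 2 : ℕ) : ℝ) * (P / 3 : ℕ) * (Q / 3 : ℕ)
      = (E / 2 : ℕ) * ((Q / 3 : ℕ) * ((P / 3 : ℕ) * 1)) := by ring
    _ ≤ (E / 2 : ℕ) * ((Q / 3 : ℕ) * ((P / 3 : ℕ) * maxTwist 3 3 2)) := by gcongr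
    _ ≤ (E / 2 : ℕ) * ((Q / 3 : ℕ) * maxTwist P 3 2) := by gcongr
    _ ≤ (E / 2 : ℕ) * maxTwist P Q 2 := by gcongr
    _ ≤ maxTwist P Q E := a3

theorem linkedRings_le_maxTwist {n a w B H : ℕ} (hn : 4 * a + 2 * w ≤ n) (hB : 2 * w ≤ B)
    (hH : 2 * a ≤ H) (h : Even n ∨ Even B ∨ Even H) :
    (a : ℝ) * w * (B - 2 * w) * (H - 2 * a) ≤ maxTwist n B H :=
  (le_maxTwist (linkedRings_mem_twistSet hB hH)).trans
    (maxTwist_mono hn (Or.inl ⟨2 * a + w, by ring⟩) h)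

/-! ### The lower bound -/

/-- The lower bound for the maximal twist of the `L × M × N` box. -/
def HasLowerBound (L M N : ℕ) : Prop :=
  (1 / 162 : ℝ) * ((L : ℝ) * M * N * min (L : ℝ) (min (M : ℝ) N)) ≤ maxTwist L M N

theorem HasLowerBound.swap_left {L M N : ℕ} (h : HasLowerBound L M N) : HasLowerBound M L N := by
  unfold HasLowerBound at *
  rw [maxTwist_swap_left, min_left_comm, mul_comm (M : ℝ)]
  exact h

theorem HasLowerBound.swap_right {L M N : ℕ} (h : HasLowerBound L M N) : HasLowerBound L N M := by
  unfold HasLowerBound at *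
  rw [maxTwist_swap_right, min_comm (N : ℝ), mul_right_comm (L : ℝ)]
  exact h

theorem hasLowerBound_of_le {L M N v : ℕ} (hv : min L (min M N) ≤ v)
    (h : (1 / 162 : ℝ) * ((L : ℝ) * M * N * v) ≤ maxTwist L M N) : HasLowerBound L M N := by
  have : min (L : ℝ) (min (M : ℝ) N) ≤ v := by exact_mod_cast hv
  refine le_trans ?_ h
  gcongr

/-- Equality holds at n = 10, and n = 11 is the only failure. Squared, the estimate gives the factor
4/625, which exceeds 1/162. -/
theorem twentyFive_mul_div_six {n : ℕ} (hn : 6 ≤ n) (h11 : n ≠ 11) :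
    2 * (n : ℝ) ^ 2 ≤ 25 * ((n / 6 : ℕ) * (n - 2 * (n / 6 : ℕ))) := by
  obtain ⟨k, r, hr, rfl⟩ : ∃ k r, r < 6 ∧ n = 6 * k + r :=
    ⟨n / 6, n % 6, Nat.mod_lt _ (by norm_num), (Nat.div_add_mod n 6).symm⟩
  have hk : (6 * k + r) / 6 = k := by omega
  rw [hk]
  push_cast
  have h1 : (1 : ℝ) ≤ k := by exact_mod_cast (show 1 ≤ k by omega)
  rcases Nat.lt_or_ge k 2 with h2 | h2
  · have : k = 1 := by omega
    subst this
    interval_cases r <;> norm_num at *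
  · have h3 : (2 : ℝ) ≤ k := by exact_mod_cast h2
    have h4 : (r : ℝ) ≤ 5 := by exact_mod_cast (show r ≤ 5 by omega)
    have h5 : (0 : ℝ) ≤ r := Nat.cast_nonneg r
    nlinarith [mul_nonneg h5 (by linarith : (0 : ℝ) ≤ k), mul_nonneg h5 (sub_nonneg.2 h4)]

theorem hasLowerBound_of_six_le {n B H : ℕ} (hn : 6 ≤ n) (hB : n ≤ B) (hH : n ≤ H)
    (h : Even n ∨ Even B ∨ Even H) : HasLowerBound n B H := by
  refine hasLowerBound_of_le (v := n) (min_le_left _ _) ?_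
  have hn0 : (6 : ℝ) ≤ n := by exact_mod_cast hn
  have hB' : (n : ℝ) ≤ B := by exact_mod_cast hB
  have hH' : (n : ℝ) ≤ H := by exact_mod_cast hH
  by_cases h11 : n = 11
  · subst h11
    -- Here ⌊11/6⌋ = 1 would use only 6 of the 11 layers; a = 1 and w = 3 use 10.
    have key := linkedRings_le_maxTwist (a := 1) (w := 3) (n := 11) (B := B) (H := H) (by norm_num)
      (by omega) (by omega) h
    refine le_trans ?_ key
    push_cast at *
    have h1 : 5 * (B : ℝ) ≤ 11 * (B - 6) := by linarith
    have h2 : 9 * (H : ℝ) ≤ 11 * (H - 2) := by linarith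
    have h3 := mul_le_mul h1 h2 (by positivity) (by linarith)
    have h4 : (0 : ℝ) ≤ B * H := by positivity
    nlinarith
  · have key := linkedRings_le_maxTwist (a := n / 6) (w := n / 6) (n := n) (B := B) (H := H)
      (by omega) (by omega) (by omega) h
    refine le_trans ?_ key
    have h0 := twentyFive_mul_div_six hn h11
    have hk : 6 * ((n / 6 : ℕ) : ℝ) ≤ n := by exact_mod_cast Nat.mul_div_le n 6
    generalize ((n / 6 : ℕ) : ℝ) = k at *
    have hk0 : 0 ≤ k := by nlinarith
    -- The proportion lost to the margins 2k is largest when B and H equal n.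
    have h1 : (B : ℝ) * (n - 2 * k) ≤ n * (B - 2 * k) := by nlinarith
    have h2 : (H : ℝ) * (n - 2 * k) ≤ n * (H - 2 * k) := by nlinarith
    have h3 := mul_le_mul h1 h2 (by apply mul_nonneg <;> linarith) (by nlinarith)
    have h4 := mul_le_mul h0 h0 (by positivity) (by nlinarith)
    have hBH : (0 : ℝ) ≤ B * H := by positivity
    have h5 := mul_le_mul_of_nonneg_left h4 hBH
    have h6 := mul_le_mul_of_nonneg_left h3 (sq_nonneg k)
    have hpos : (0 : ℝ) < n ^ 2 := by positivity
    refine le_of_mul_le_mul_left ?_ hpos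
    have h7 : (0 : ℝ) ≤ B * H * (n : ℝ) ^ 4 := by positivity
    nlinarith

/-- For M ≥ 6 the side 5 is cut into 3 + 2, with blocks oriented differently in the two parts. For M
= 5 this can fail (E = 8 yields 6 < 1000/162), so linked rings of twist 9 in 6 × 5 × 5 boxes are
lined up along E. -/
theorem hasLowerBound_five {M E : ℕ} (hM : 5 ≤ M) (hE : Even E) (hE6 : 6 ≤ E) :
    HasLowerBound 5 M E := by
  refine hasLowerBound_of_le (v := 5) (min_le_left _ _) ?_
  obtain ⟨e, he⟩ := hE
  have hE' : Even E := ⟨e, he⟩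
  rcases eq_or_lt_of_le hM with rfl | hM6
  · have h1 := linkedRings_le_maxTwist (a := 1) (w := 1) (n := 6) (B := 5) (H := 5) le_rfl
      (by norm_num) (by norm_num) (Or.inl ⟨3, rfl⟩)
    have h2 : ((E / 6 : ℕ) : ℝ) * maxTwist 6 5 5 ≤ maxTwist E 5 5 :=
      div_mul_maxTwist_le (Or.inl ⟨3, rfl⟩) (Or.inl hE')
    rw [maxTwist_rotate] at *
    have h3 : (E : ℝ) ≤ 6 * (E / 6 : ℕ) + 4 := by exact_mod_cast (show E ≤ 6 * (E / 6) + 4 by omega)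
    have h4 : (1 : ℝ) ≤ (E / 6 : ℕ) := by exact_mod_cast (show 1 ≤ E / 6 by omega)
    push_cast at *
    nlinarith
  · have h1 := maxTwist_add_le (L := 3) (L' := 2) (M := M) (N := E) (Or.inr (Or.inr hE'))
      (Or.inr (Or.inr hE'))
    have h2 := blocks_le_maxTwist (P := 3) (Q := M) hE'
    have h3 := blocks_le_maxTwist (P := M) (Q := E) even_two
    rw [maxTwist_rotate 2 M E] at h3
    norm_num at h1 h2 h3
    have h4 : (M : ℝ) ≤ 4 * (M / 3 : ℕ) := by exact_mod_cast (show M ≤ 4 * (M / 3) by omega)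
    have h5 : (E : ℝ) ≤ 4 * (E / 3 : ℕ) := by exact_mod_cast (show E ≤ 4 * (E / 3) by omega)
    have h6 : (E : ℝ) = 2 * (E / 2 : ℕ) := by exact_mod_cast (show E = 2 * (E / 2) by omega)
    generalize ((E / 2 : ℕ) : ℝ) = e2 at *
    generalize ((E / 3 : ℕ) : ℝ) = e3 at *
    generalize ((M / 3 : ℕ) : ℝ) = m3 at *
    have hE0 : (0 : ℝ) ≤ E := Nat.cast_nonneg E
    have hm0 : (0 : ℝ) ≤ M := Nat.cast_nonneg M
    have h7 : (M : ℝ) * E ≤ 4 * m3 * E := by nlinarith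
    have h8 : m3 * E ≤ 4 * (m3 * e3) := by nlinarith
    push_cast
    nlinarith

theorem hasLowerBound_four_five_five : HasLowerBound 5 5 4 := by
  refine hasLowerBound_of_le (v := 4) (by norm_num) ?_
  have he : Even 4 := ⟨2, rfl⟩
  have h1 := maxTwist_add_le (L := 3) (L' := 2) (M := 5) (N := 4) (Or.inr (Or.inr he))
    (Or.inr (Or.inr he))
  have h2 := blocks_le_maxTwist (P := 3) (Q := 5) he
  have h3 := blocks_le_maxTwist (P := 5) (Q := 4) even_two
  rw [maxTwist_rotate 2 5 4] at h3
  norm_num at h1 h2 h3 ⊢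
  linarith

theorem le_five_mul_div {n : ℕ} (h : 3 ≤ n) : (n : ℝ) ≤ 5 * (n / 3 : ℕ) := by
  exact_mod_cast (show n ≤ 5 * (n / 3) by omega)

theorem le_four_mul_div {n : ℕ} (h : 6 ≤ n) : (n : ℝ) ≤ 4 * (n / 3 : ℕ) := by
  exact_mod_cast (show n ≤ 4 * (n / 3) by omega)

/-- The lower bound for boxes of which an even dimension comes last. -/
theorem hasLowerBound_of_even {L M E : ℕ} (hLM : L ≤ M) (hL : 2 ≤ L) (hM : 2 < M) (hE2 : 2 ≤ E)
    (h : 2 < L ∨ 2 < E) (hE : Even E) : HasLowerBound L M E := by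
  have hE' := Nat.even_iff.1 hE
  have hb := blocks_le_maxTwist (P := L) (Q := M) hE
  have h2 : (E : ℝ) = 2 * (E / 2 : ℕ) := by exact_mod_cast (show E = 2 * (E / 2) by omega)
  have hM5 := le_five_mul_div hM
  have hE0 : (0 : ℝ) ≤ (E / 2 : ℕ) := Nat.cast_nonneg _
  have hM0 : (0 : ℝ) ≤ M := Nat.cast_nonneg M
  have hm0 : (0 : ℝ) ≤ (M / 3 : ℕ) := Nat.cast_nonneg _
  -- Linked rings apply when L and E are at least 6. Otherwise blocks in a single orientation
  -- suffice, except for 5 × 5 × 4 and for L = 5 with E ≥ 6, where they can fall short.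
  rcases (show L = 2 ∨ E = 2 ∧ 3 ≤ L ∨ L = 3 ∨ L = 4 ∨ E = 4 ∧ 5 ≤ L ∨ L = 5 ∧ 6 ≤ E ∨
      6 ≤ L ∧ 6 ≤ E by omega) with rfl | ⟨rfl, h3⟩ | rfl | rfl | ⟨rfl, h5⟩ | ⟨rfl, h6⟩ | ⟨h6, h6'⟩
  · refine hasLowerBound_of_le (v := 2) (min_le_left _ _) ?_
    have h3 := blocks_le_maxTwist (P := M) (Q := E) even_two
    rw [maxTwist_rotate 2 M E] at h3
    have hE5 := le_five_mul_div (show 3 ≤ E by omega)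
    have h4 := mul_le_mul hM5 hE5 (Nat.cast_nonneg _) (by positivity)
    norm_num at h3
    push_cast
    nlinarith
  · refine hasLowerBound_of_le (v := 2) (by omega) ?_
    have hL5 := le_five_mul_div h3
    have h4 := mul_le_mul hL5 hM5 (Nat.cast_nonneg _) (by positivity)
    norm_num at hb
    push_cast
    nlinarith
  · refine hasLowerBound_of_le (v := 3) (min_le_left _ _) ?_
    norm_num at hb
    rw [h2]
    push_cast
    nlinarith
  · refine hasLowerBound_of_le (v := 4) (min_le_left _ _) ?_
    norm_num at hb
    rw [h2]
    push_cast
    nlinarith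
  · rcases (show L = 5 ∧ M = 5 ∨ L = 5 ∧ 6 ≤ M ∨ 6 ≤ L by omega) with ⟨rfl, rfl⟩ | ⟨rfl, hM6⟩ | hL6
    · exact hasLowerBound_four_five_five
    · refine hasLowerBound_of_le (v := 4) (by omega) ?_
      have := le_four_mul_div hM6
      norm_num at hb
      push_cast
      nlinarith
    · refine hasLowerBound_of_le (v := 4) (by omega) ?_
      have h4 := mul_le_mul (le_four_mul_div hL6) (le_four_mul_div (hL6.trans hLM))
        (Nat.cast_nonneg _) (by positivity)
      norm_num at hb
      push_cast
      nlinarith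
  · exact hasLowerBound_five (by omega) hE h6
  · rcases le_total L E with hLE | hLE
    · exact hasLowerBound_of_six_le h6 hLM hLE (Or.inr (Or.inr hE))
    · exact (hasLowerBound_of_six_le h6' hLE (hLE.trans hLM) (Or.inl hE)).swap_left.swap_right

theorem hasLowerBound {L M N : ℕ} (hL : 2 ≤ L) (hM : 2 ≤ M) (hN : 2 ≤ N)
    (h : (2 < L ∧ 2 < M) ∨ (2 < L ∧ 2 < N) ∨ (2 < M ∧ 2 < N)) (he : Even L ∨ Even M ∨ Even N) :
    HasLowerBound L M N := by
  have key : ∀ {L M N : ℕ}, 2 ≤ L → 2 ≤ M → 2 ≤ N →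
      ((2 < L ∧ 2 < M) ∨ (2 < L ∧ 2 < N) ∨ (2 < M ∧ 2 < N)) → Even N → HasLowerBound L M N := by
    intro L M N hL hM hN h hE
    rcases le_total L M with hLM | hLM
    · exact hasLowerBound_of_even hLM hL (by omega) hN (by omega) hE
    · exact (hasLowerBound_of_even hLM hM (by omega) hN (by omega) hE).swap_left
  rcases he with he | he | he
  · exact (key hM hN hL (by tauto) he).swap_right.swap_left
  · exact (key hL hN hM (by tauto) he).swap_right
  · exact key hL hM hN h he

/-! ### Limits -/

open Filter Topology

theorem ratio_le (p : ℕ × ℕ × ℕ) : ratio p ≤ 1 / 16 := by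
  unfold ratio
  exact div_le_of_le_mul₀ (by positivity) (by norm_num) (maxTwist_le _ _ _)

theorem eventually_tileable : ∀ᶠ p in toInftyTileable, Even p.1 ∨ Even p.2.1 ∨ Even p.2.2 :=
  mem_inf_of_right (mem_principal_self _)

theorem ratio_nonneg {p : ℕ × ℕ × ℕ} (h : Even p.1 ∨ Even p.2.1 ∨ Even p.2.2) : 0 ≤ ratio p :=
  div_nonneg (maxTwist_nonneg h) (by positivity)

theorem tendsto_toInftyTileable {f g h : ℕ → ℕ} (hf : Tendsto f atTop atTop)
    (hg : Tendsto g atTop atTop) (hh : Tendsto h atTop atTop) (he : ∀ k, Even (f k)) :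
    Tendsto (fun k => (f k, g k, h k)) atTop toInftyTileable :=
  tendsto_inf.2 ⟨hf.prodMk (hg.prodMk hh), tendsto_principal.2 (Eventually.of_forall fun k =>
    Or.inl (he k))⟩

theorem ratio_cube_le {n : ℕ} (hn : 0 < n) : ratio (n, n, n) ≤ 1 / 24 := by
  unfold ratio
  have : (0 : ℝ) < n := by exact_mod_cast hn
  simp only [min_self]
  rw [div_le_iff₀ (by positivity)]
  exact maxTwist_cube_le n

/-- Cubes of even side tend to infinity along the filter, so every eventual lower bound is at most
1/24; the bound 0 shows that there is one. -/
theorem liminf_ratio_le : liminf ratio toInftyTileable ≤ 1 / 24 := by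
  rw [liminf_eq]
  refine csSup_le ⟨0, eventually_tileable.mono fun p hp => ratio_nonneg hp⟩ ?_
  intro b hb
  have h2 : Tendsto (fun k : ℕ => 2 * k) atTop atTop :=
    tendsto_id.const_mul_atTop' (by norm_num)
  have h := (tendsto_toInftyTileable h2 h2 h2 fun k => even_two_mul k).eventually hb
  obtain ⟨k, hk, hk0⟩ := (h.and (eventually_gt_atTop 0)).exists
  exact hk.trans (ratio_cube_le (by omega))

/-- Here a = k, w = k², B = 4k³ and H = 4k: a = H/4 balances the two directions in a column, and a ≪
w ≪ B lets almost all columns pass through an arm. -/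
theorem le_ratio_linkedRings {k : ℕ} (hk : 0 < k) :
    (1 / 16 : ℝ) * ((1 - 1 / (2 * k)) / (1 + 2 / k)) ≤
      ratio (4 * k + 2 * k ^ 2, 4 * k ^ 3, 4 * k) := by
  have h1 : (1 : ℝ) ≤ k := by exact_mod_cast hk
  have hk2 : k ^ 2 ≤ k ^ 3 := Nat.pow_le_pow_right hk (by norm_num)
  have hk1 : k ≤ k ^ 3 := Nat.le_self_pow (by norm_num) k
  have key := linkedRings_le_maxTwist (a := k) (w := k ^ 2) (B := 4 * k ^ 3) (H := 4 * k)
    le_rfl (by omega) (by omega) (Or.inl ⟨2 * k + k ^ 2, by ring⟩)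
  unfold ratio
  have hmin : min (((4 * k + 2 * k ^ 2 : ℕ) : ℝ)) (min ((4 * k ^ 3 : ℕ) : ℝ) ((4 * k : ℕ) : ℝ)) =
      4 * k := by
    have : min (4 * k + 2 * k ^ 2) (min (4 * k ^ 3) (4 * k)) = 4 * k := by omega
    exact_mod_cast this
  simp only [hmin]
  rw [le_div_iff₀ (by push_cast; positivity)]
  refine le_trans (le_of_eq ?_) key
  push_cast
  have h0 : (k : ℝ) ≠ 0 := by positivity
  have h3 : (1 : ℝ) + 2 / k ≠ 0 := by positivity
  have h4 : (k : ℝ) + 2 ≠ 0 := by positivity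
  field_simp
  ring

theorem tendsto_ratio_bound :
    Tendsto (fun k : ℕ => (1 / 16 : ℝ) * ((1 - 1 / (2 * (k : ℝ))) / (1 + 2 / (k : ℝ)))) atTop
      (𝓝 (1 / 16)) := by
  have h1 : Tendsto (fun k : ℕ => 1 / (k : ℝ)) atTop (𝓝 0) := tendsto_one_div_atTop_nhds_zero_nat
  have h2 := (((h1.const_mul (1 / 2)).const_sub 1).div ((h1.const_mul 2).const_add 1)
    (by norm_num)).const_mul (1 / 16 : ℝ)
  norm_num at h2
  refine h2.congr fun k => ?_
  simp only [div_eq_mul_inv, mul_inv, one_mul]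

theorem limsup_ratio : limsup ratio toInftyTileable = 1 / 16 := by
  rw [limsup_eq]
  refine IsLeast.csInf_eq
    ⟨show ∀ᶠ p in toInftyTileable, ratio p ≤ 1 / 16 from Eventually.of_forall ratio_le, ?_⟩
  intro b hb
  have hpow : ∀ n : ℕ, n ≠ 0 → Tendsto (fun k : ℕ => k ^ n) atTop atTop := fun n hn =>
    tendsto_pow_atTop hn
  have hmul : ∀ f : ℕ → ℕ, Tendsto f atTop atTop → ∀ c : ℕ, 0 < c →
      Tendsto (fun k => c * f k) atTop atTop := fun f hf c hc => hf.const_mul_atTop' hc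
  have h4 : Tendsto (fun k : ℕ => 4 * k) atTop atTop := hmul _ tendsto_id 4 (by norm_num)
  have h := (tendsto_toInftyTileable (h4.atTop_add_atTop (hmul _ (hpow 2 (by norm_num)) 2
    (by norm_num))) (hmul _ (hpow 3 (by norm_num)) 4 (by norm_num)) h4
    fun k => ⟨2 * k + k ^ 2, by ring⟩).eventually hb
  refine le_of_tendsto tendsto_ratio_bound ?_
  filter_upwards [h, eventually_gt_atTop 0] with k hk hk0
  exact (le_ratio_linkedRings hk0).trans hk

end DominoTwist

theorem mainTheorem4 :
    -- the three pretwists of a tiling of a box agree, so that its twist is well defined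
    (∀ (L M N : ℕ) (t : Finset DominoTwist.Domino), DominoTwist.IsTiling L M N t →
      ∀ i : Fin 3, DominoTwist.pretwist (DominoTwist.basisVec i) t = DominoTwist.twist t) ∧
    (∀ L M N : ℕ, 2 ≤ L → 2 ≤ M → 2 ≤ N →
      ((2 < L ∧ 2 < M) ∨ (2 < L ∧ 2 < N) ∨ (2 < M ∧ 2 < N)) →
      (Even L ∨ Even M ∨ Even N) →
      (1 / 162 : ℝ) * ((L : ℝ) * M * N * min (L : ℝ) (min (M : ℝ) N))
          ≤ DominoTwist.maxTwist L M N ∧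
        DominoTwist.maxTwist L M N
          ≤ (1 / 16 : ℝ) * ((L : ℝ) * M * N * min (L : ℝ) (min (M : ℝ) N))) ∧
    Filter.limsup DominoTwist.ratio DominoTwist.toInftyTileable = 1 / 16 ∧
    Filter.liminf DominoTwist.ratio DominoTwist.toInftyTileable ≤ 1 / 24 := by
  exact ⟨fun L M N t ht i => ht.pretwist_eq_twist i,
    fun L M N hL hM hN h he => ⟨DominoTwist.hasLowerBound hL hM hN h he,
      DominoTwist.maxTwist_le L M N⟩,
    DominoTwist.limsup_ratio, DominoTwist.liminf_ratio_le⟩
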